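/- For $A,B\in U(2)$ with $\det A=\det B$, let $G(A,B)$ be the two-qubit gate that acts as $A$ on the even-parity subspace (ordered basis $|00\rangle,|11\rangle$) and as $B$ on the odd-parity subspace (ordered basis $|01\rangle,|10\rangle$). Let $(C_n)_{n\in\mathbb N}$ be a uniform family of quantum circuits in which every gate is such a $G(A,B)$ acting on a pair of nearest-neighbour lines. Uniform means: $C_n$ acts on $w(n)$ qubit lines with $w$ polynomially bounded, and a deterministic classical algorithm outputs on input $(n,l)$, in time $\mathrm{poly}(n,l)$, the number $w(n)$ and the list of the gates of $C_n$, each given by its position and by the real and imaginary parts of its matrix entries to $l$ binary digits (so $C_n$ has $\mathrm{poly}(n)$ gates). A real number $r$ is given to $l$ binary digits by an integer $z$ with $|z/2^l-r|\le 2^{-l}$; running times count bit operations. Then there are a polynomial $q$ and a deterministic classical algorithm, running in time $\mathrm{poly}(n,m)$, both depending only on the family, such that for all $n,m$, every line $k$ of $C_n$ and every product state $|\psi_{\rm in}\rangle=|\varphi_1\rangle\cdots|\varphi_{w(n)}\rangle$ of unit vectors the following holds. Let $|\psi_{\rm out}\rangle=C_n|\psi_{\rm in}\rangle$, and let $p_0,p_1$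 be the probabilities of the outcomes $0,1$ of a computational-basis measurement of line $k$ in the state $|\psi_{\rm out}\rangle$. Then $\langle Z_k\rangle_{\rm out}=\langle\psi_{\rm out}|Z_k|\psi_{\rm out}\rangle=p_0-p_1$, where $Z_k$ is the Pauli operator $Z$ on line $k$; and the algorithm, given $n$, $m$, $k$ and the amplitudes of $|\varphi_1\rangle,\dots,|\varphi_{w(n)}\rangle$ to $q(n+m)$ binary digits, outputs $\langle Z_k\rangle_{\rm out}$, $p_0$ and $p_1$ to $m$ binary digits. -/

import Mathlib

/-! # Nearest-neighbour matchgate circuits and polynomial-time classical simulation -/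

noncomputable section

namespace Matchgate

/-! ## Quantum circuits of nearest-neighbour `G(A,B)` gates -/

/-- Computational basis labels of `w` qubit lines. -/
abbrev Basis (w : ℕ) : Type := Fin w → Fin 2

/-- Vectors of amplitudes of `w` qubit lines. -/
abbrev StateVec (w : ℕ) : Type := Basis w → ℂ

/-- The two-qubit matrix `G(A,B)`.  The entry at row `|a b⟩`, column `|c d⟩`: the matrix `A` acts on
the even-parity subspace with basis `|00⟩, |11⟩`, the matrix `B` acts on the odd-parity subspace with
basis `|01⟩, |10⟩`, and the two subspaces are not mixed. -/
def gab (A B : Matrix (Fin 2) (Fin 2) ℂ) : Matrix (Fin 2 × Fin 2) (Fin 2 × Fin 2) ℂ :=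
  fun r c =>
    if r.1 = r.2 ∧ c.1 = c.2 then A r.1 c.1
    else if r.1 ≠ r.2 ∧ c.1 ≠ c.2 then B r.1 c.1
    else 0

/-- The operator on `w` lines that acts as the two-qubit matrix `U` on the lines `i, j`
(in this order) and as the identity on all other lines. -/
def onLines {w : ℕ} (U : Matrix (Fin 2 × Fin 2) (Fin 2 × Fin 2) ℂ) (i j : Fin w) :
    Matrix (Basis w) (Basis w) ℂ :=
  fun x y => if ∀ l, l ≠ i → l ≠ j → x l = y l then U (x i, x j) (y i, y j) else 0

/-- An allowable gate `G(A,B)` applied to the neighbouring lines `pos, pos + 1` among `w` lines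
(lines are numbered from `0`). -/
structure Gate (w : ℕ) where
  pos : ℕ
  pos_lt : pos + 1 < w
  A : Matrix (Fin 2) (Fin 2) ℂ
  B : Matrix (Fin 2) (Fin 2) ℂ
  A_unitary : A ∈ Matrix.unitaryGroup (Fin 2) ℂ
  B_unitary : B ∈ Matrix.unitaryGroup (Fin 2) ℂ
  det_eq : A.det = B.det

/-- The action of a gate on all `w` lines. -/
def Gate.toMatrix {w : ℕ} (g : Gate w) : Matrix (Basis w) (Basis w) ℂ :=
  onLines (gab g.A g.B) ⟨g.pos, (Nat.lt_succ_self _).trans g.pos_lt⟩ ⟨g.pos + 1, g.pos_lt⟩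

/-- A circuit on `w` lines: its gates in the order in which they are applied. -/
abbrev Circuit (w : ℕ) : Type := List (Gate w)

/-- The final state of a circuit that is run on the state `ψ`. -/
def Circuit.output {w : ℕ} (C : Circuit w) (ψ : StateVec w) : StateVec w :=
  C.foldl (fun v g => g.toMatrix.mulVec v) ψ

/-- The product vector `|φ₀⟩ ⊗ ⋯ ⊗ |φ_{w-1}⟩`. -/
def productState {w : ℕ} (φ : Fin w → Fin 2 → ℂ) : StateVec w :=
  fun x => ∏ j, φ j (x j)

/-- The Pauli operator `Z` on line `k`. -/
def pauliZ {w : ℕ} (k : Fin w) : Matrix (Basis w) (Basis w) ℂ :=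
  Matrix.diagonal fun x => if x k = 0 then 1 else -1

/-- The expectation value `⟨ψ| Z_k |ψ⟩`. -/
def expZ {w : ℕ} (k : Fin w) (ψ : StateVec w) : ℂ :=
  star ψ ⬝ᵥ (pauliZ k).mulVec ψ

/-- The probability of the outcome `b` when line `k` of the state `ψ` is measured in the
computational basis. -/
def outcomeProb {w : ℕ} (k : Fin w) (b : Fin 2) (ψ : StateVec w) : ℝ :=
  ∑ x : Basis w, if x k = b then ‖ψ x‖ ^ 2 else 0

/-! ## Classical deterministic computation with a bit-cost step count

Programs compute on finite binary trees whose leaves are integers.  An elementary operation on `x`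
with result `y` takes `(|x| + |y|) ^ 2` steps, where `|·|` is the number of bits needed to write a
tree down: this leaves room for copying the data and for schoolbook arithmetic. -/

/-- Finite binary trees with integer leaves. -/
inductive Data : Type
  | int (z : ℤ)
  | pair (a b : Data)

/-- The number of symbols of a tree; integers are written in binary. -/
def Data.size : Data → ℕ
  | .int z => Nat.size z.natAbs + 2
  | .pair a b => a.size + b.size + 1

/-- Lists of trees as right-nested pairs that end in the leaf `0`. -/
def Data.list : List Data → Data
  | [] => .int 0
  | a :: l => .pair a (Data.list l)

/-- The outcome of a test: positive integers count as true, everything else as false. -/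
def Data.IsTrue : Data → Prop
  | .int z => 0 < z
  | .pair _ _ => False

/-- Elementary operations. -/
inductive Op : Type
  | id
  | const (z : ℤ)
  | fst
  | snd
  | add
  | sub
  | mul
  | half
  | isPair

/-- The value of an elementary operation (`0` where it makes no sense).  The operation `half`
rounds down: it deletes the last binary digit. -/
def Op.eval : Op → Data → Data
  | .id, x => x
  | .const z, _ => .int z
  | .fst, .pair a _ => a
  | .snd, .pair _ b => b
  | .add, .pair (.int a) (.int b) => .int (a + b)
  | .sub, .pair (.int a) (.int b) => .int (a - b)
  | .mul, .pair (.int a) (.int b) => .int (a * b)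
  | .half, .int a => .int (a / 2)
  | .isPair, .pair _ _ => .int 1
  | _, _ => .int 0

/-- Programs: elementary operations, pairing of two results, composition (`comp f g` runs `g`
first), branching and while-loops. -/
inductive Prog : Type
  | op (o : Op)
  | pair (f g : Prog)
  | comp (f g : Prog)
  | cond (c f g : Prog)
  | loop (c f : Prog)

/-- `Runs p x y t`: the program `p`, started on `x`, halts after exactly `t` steps with
output `y`. -/
inductive Runs : Prog → Data → Data → ℕ → Prop
  | op (o : Op) (x : Data) : Runs (.op o) x (o.eval x) ((x.size + (o.eval x).size) ^ 2)
  | pair {f g : Prog} {x a b : Data} {s t : ℕ} :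
      Runs f x a s → Runs g x b t → Runs (.pair f g) x (.pair a b) (s + t + 1)
  | comp {f g : Prog} {x y z : Data} {s t : ℕ} :
      Runs g x y s → Runs f y z t → Runs (.comp f g) x z (s + t + 1)
  | cond_true {c f g : Prog} {x b y : Data} {s t : ℕ} :
      Runs c x b s → b.IsTrue → Runs f x y t → Runs (.cond c f g) x y (s + t + 1)
  | cond_false {c f g : Prog} {x b y : Data} {s t : ℕ} :
      Runs c x b s → ¬ b.IsTrue → Runs g x y t → Runs (.cond c f g) x y (s + t + 1)
  | loop_stop {c f : Prog} {x b : Data} {s : ℕ} :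
      Runs c x b s → ¬ b.IsTrue → Runs (.loop c f) x x (s + 1)
  | loop_step {c f : Prog} {x b y z : Data} {s t u : ℕ} :
      Runs c x b s → b.IsTrue → Runs f x y t → Runs (.loop c f) y z u →
      Runs (.loop c f) x z (s + t + u + 1)

/-- Programs are deterministic. -/
theorem Runs.unique {p : Prog} {x y : Data} {t : ℕ} (h : Runs p x y t) :
    ∀ {y' : Data} {t' : ℕ}, Runs p x y' t' → y = y' ∧ t = t' := by
  induction h with
  | op o x => intro y' t' h'; cases h'; exact ⟨rfl, rfl⟩
  | pair _ _ ih₁ ih₂ =>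
    intro y' t' h'
    cases h' with
    | pair h₁ h₂ =>
      obtain ⟨rfl, rfl⟩ := ih₁ h₁; obtain ⟨rfl, rfl⟩ := ih₂ h₂; exact ⟨rfl, rfl⟩
  | comp _ _ ih₁ ih₂ =>
    intro y' t' h'
    cases h' with
    | comp h₁ h₂ =>
      obtain ⟨rfl, rfl⟩ := ih₁ h₁; obtain ⟨rfl, rfl⟩ := ih₂ h₂; exact ⟨rfl, rfl⟩
  | cond_true _ hb _ ih₁ ih₂ =>
    intro y' t' h'
    cases h' with
    | cond_true h₁ _ h₂ =>
      obtain ⟨rfl, rfl⟩ := ih₁ h₁; obtain ⟨rfl, rfl⟩ := ih₂ h₂; exact ⟨rfl, rfl⟩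
    | cond_false h₁ hb' _ => obtain ⟨rfl, rfl⟩ := ih₁ h₁; exact absurd hb hb'
  | cond_false _ hb _ ih₁ ih₂ =>
    intro y' t' h'
    cases h' with
    | cond_true h₁ hb' _ => obtain ⟨rfl, rfl⟩ := ih₁ h₁; exact absurd hb' hb
    | cond_false h₁ _ h₂ =>
      obtain ⟨rfl, rfl⟩ := ih₁ h₁; obtain ⟨rfl, rfl⟩ := ih₂ h₂; exact ⟨rfl, rfl⟩
  | loop_stop _ hb ih₁ =>
    intro y' t' h'
    cases h' with
    | loop_stop h₁ _ => obtain ⟨rfl, rfl⟩ := ih₁ h₁; exact ⟨rfl, rfl⟩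
    | loop_step h₁ hb' _ _ => obtain ⟨rfl, rfl⟩ := ih₁ h₁; exact absurd hb' hb
  | loop_step _ hb _ _ ih₁ ih₂ ih₃ =>
    intro y' t' h'
    cases h' with
    | loop_stop h₁ hb' => obtain ⟨rfl, rfl⟩ := ih₁ h₁; exact absurd hb hb'
    | loop_step h₁ _ h₂ h₃ =>
      obtain ⟨rfl, rfl⟩ := ih₁ h₁; obtain ⟨rfl, rfl⟩ := ih₂ h₂
      obtain ⟨rfl, rfl⟩ := ih₃ h₃; exact ⟨rfl, rfl⟩

/-! ## Descriptions of numbers, states and circuits to finitely many binary digits -/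

/-- The integer `z` gives the real number `r` to `l` binary digits: `|z / 2 ^ l - r| ≤ 2 ^ (-l)`. -/
def ApproxReal (l : ℕ) (r : ℝ) (z : ℤ) : Prop :=
  |(z : ℝ) / 2 ^ l - r| ≤ 1 / 2 ^ l

/-- The tree `d` describes the complex number `c` to `l` binary digits. -/
def ApproxComplex (l : ℕ) (c : ℂ) (d : Data) : Prop :=
  ∃ x y : ℤ, d = .pair (.int x) (.int y) ∧ ApproxReal l c.re x ∧ ApproxReal l c.im y

/-- The tree `d` describes the single-qubit vector `v` to `l` binary digits. -/
def ApproxQubit (l : ℕ) (v : Fin 2 → ℂ) (d : Data) : Prop :=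
  ∃ a b : Data, d = .pair a b ∧ ApproxComplex l (v 0) a ∧ ApproxComplex l (v 1) b

/-- The tree `d` describes, line by line, the factors of a product state to `l` binary digits. -/
def ApproxProduct (l : ℕ) {w : ℕ} (φ : Fin w → Fin 2 → ℂ) (d : Data) : Prop :=
  ∃ e : Fin w → Data, d = Data.list (List.ofFn e) ∧ ∀ j, ApproxQubit l (φ j) (e j)

/-- The tree `d` describes the two rows of the matrix `M` to `l` binary digits. -/
def ApproxMatrix (l : ℕ) (M : Matrix (Fin 2) (Fin 2) ℂ) (d : Data) : Prop :=
  ∃ a b : Data, d = .pair a b ∧ ApproxQubit l (M 0) a ∧ ApproxQubit l (M 1) b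

/-- The tree `d` describes a gate: its position, and the matrices `A, B` to `l` binary digits. -/
def ApproxGate (l : ℕ) {w : ℕ} (g : Gate w) (d : Data) : Prop :=
  ∃ a b : Data, d = .pair (.int g.pos) (.pair a b) ∧ ApproxMatrix l g.A a ∧ ApproxMatrix l g.B b

/-- The tree `d` describes a circuit: the number of its lines, and the list of its gates with
matrix entries to `l` binary digits. -/
def ApproxCircuit (l : ℕ) {w : ℕ} (C : Circuit w) (d : Data) : Prop :=
  ∃ e : List Data, d = .pair (.int w) (Data.list e) ∧ List.Forall₂ (ApproxGate l) C e

/-- A uniform family of circuits, the `n`-th one on `w n` lines: the number of lines is polynomially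
bounded, and one program produces from `n` and `l` a description of the `n`-th circuit, with gate
entries to `l` binary digits, in time polynomial in `n` and `l`.  The number of gates is then
polynomially bounded too, because writing down the output counts as running time. -/
def IsUniform (w : ℕ → ℕ) (C : ∀ n, Circuit (w n)) : Prop :=
  ∃ (P : Prog) (T : Polynomial ℕ),
    (∀ n, w n ≤ T.eval n) ∧
    ∀ n l : ℕ, ∃ (d : Data) (t : ℕ),
      Runs P (.pair (.int n) (.int l)) d t ∧ t ≤ T.eval (n + l) ∧ ApproxCircuit l (C n) d

end Matchgate

end

namespace Matchgate

/-! ## Polynomial bounds -/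

/-- The quantity `g` is bounded by a polynomial in the parameter `N`. -/
def PolyBdd {ι : Type} (N g : ι → ℕ) : Prop :=
  ∃ T : Polynomial ℕ, ∀ i, g i ≤ T.eval (N i)

theorem polynomial_eval_mono (T : Polynomial ℕ) : Monotone fun n : ℕ => T.eval n := by
  intro a b hab
  simp only [Polynomial.eval_eq_sum, Polynomial.sum]
  gcongr

namespace PolyBdd

variable {ι κ : Type} {N g h : ι → ℕ}

theorem mono (hg : PolyBdd N g) (hh : ∀ i, h i ≤ g i) : PolyBdd N h :=
  hg.imp fun _ hT i => (hh i).trans (hT i)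

theorem const (c : ℕ) : PolyBdd N fun _ => c :=
  ⟨Polynomial.C c, fun i => by simp⟩

theorem self : PolyBdd N N := ⟨Polynomial.X, fun i => by simp⟩

theorem add (hg : PolyBdd N g) (hh : PolyBdd N h) : PolyBdd N fun i => g i + h i := by
  obtain ⟨S, hS⟩ := hg
  obtain ⟨T, hT⟩ := hh
  exact ⟨S + T, fun i => by simpa using Nat.add_le_add (hS i) (hT i)⟩

theorem mul (hg : PolyBdd N g) (hh : PolyBdd N h) : PolyBdd N fun i => g i * h i := by
  obtain ⟨S, hS⟩ := hg
  obtain ⟨T, hT⟩ := hh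
  exact ⟨S * T, fun i => by simpa using Nat.mul_le_mul (hS i) (hT i)⟩

theorem pow (hg : PolyBdd N g) (c : ℕ) : PolyBdd N fun i => g i ^ c := by
  obtain ⟨S, hS⟩ := hg
  exact ⟨S ^ c, fun i => by simpa using Nat.pow_le_pow_left (hS i) c⟩

theorem poly (hg : PolyBdd N g) (T : Polynomial ℕ) : PolyBdd N fun i => T.eval (g i) := by
  obtain ⟨S, hS⟩ := hg
  exact ⟨T.comp S, fun i => by simpa using polynomial_eval_mono T (hS i)⟩

theorem reindex (hg : PolyBdd N g) (r : κ → ι) :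
    PolyBdd (fun j => N (r j)) fun j => g (r j) :=
  hg.imp fun _ hT j => hT (r j)

/-- Rounds of a loop are indexed by an instance together with a round number; a bound that depends
on the instance alone carries over to them. -/
theorem reindex_fst {Q : ι × κ → Prop} (hg : PolyBdd N g) :
    PolyBdd (fun p : {p // Q p} => N p.1.1) fun p => g p.1.1 :=
  hg.imp fun _ hT p => hT p.1.1

end PolyBdd

/-! ## Sizes and running times -/

theorem natSize_natAbs_add_le (a b : ℤ) :
    Nat.size (a + b).natAbs ≤ Nat.size a.natAbs + Nat.size b.natAbs + 1 := by
  rw [Nat.size_le]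
  have ha := Nat.lt_size_self a.natAbs
  have hb := Nat.lt_size_self b.natAbs
  have h1 : 2 ^ a.natAbs.size ≤ 2 ^ (a.natAbs.size + b.natAbs.size) :=
    Nat.pow_le_pow_right (by norm_num) (by omega)
  have h2 : 2 ^ b.natAbs.size ≤ 2 ^ (a.natAbs.size + b.natAbs.size) :=
    Nat.pow_le_pow_right (by norm_num) (by omega)
  have := Int.natAbs_add_le a b
  rw [pow_succ]
  omega

theorem natSize_natAbs_mul_le (a b : ℤ) :
    Nat.size (a * b).natAbs ≤ Nat.size a.natAbs + Nat.size b.natAbs := by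
  rw [Nat.size_le, Int.natAbs_mul, pow_add]
  exact Nat.mul_lt_mul'' (Nat.lt_size_self _) (Nat.lt_size_self _)

/-- Growth by an additive constant only: since the cost of an operation is a square of sizes, it is
polynomial on inputs of polynomial size. -/
theorem Op.exists_size_eval_le (o : Op) : ∃ C, ∀ x : Data, (o.eval x).size ≤ x.size + C := by
  cases o with
  | id => exact ⟨0, fun x => le_rfl⟩
  | const z => exact ⟨(Data.int z).size, fun x => Nat.le_add_left _ _⟩
  | fst => exact ⟨2, fun x => by cases x <;> (simp [Op.eval, Data.size]; try omega)⟩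
  | snd => exact ⟨2, fun x => by cases x <;> (simp [Op.eval, Data.size]; try omega)⟩
  | add =>
    refine ⟨2, fun x => ?_⟩
    rcases x with z | ⟨a | _, b | _⟩ <;> simp [Op.eval, Data.size]
    have := natSize_natAbs_add_le a b
    omega
  | sub =>
    refine ⟨2, fun x => ?_⟩
    rcases x with z | ⟨a | _, b | _⟩ <;> simp [Op.eval, Data.size]
    have := natSize_natAbs_add_le a (-b)
    rw [Int.natAbs_neg, ← sub_eq_add_neg] at this
    omega
  | mul =>
    refine ⟨2, fun x => ?_⟩
    rcases x with z | ⟨a | _, b | _⟩ <;> simp [Op.eval, Data.size]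
    have := natSize_natAbs_mul_le a b
    omega
  | half =>
    refine ⟨2, fun x => ?_⟩
    rcases x with z | ⟨a, b⟩ <;> simp [Op.eval, Data.size]
    have : (z / 2).natAbs.size ≤ z.natAbs.size := Nat.size_le_size (by omega)
    omega
  | isPair => exact ⟨3, fun x => by cases x <;> simp [Op.eval, Data.size]⟩

/-- Every elementary operation costs at least the sizes of its input and output, so a time bound is
also a size bound. Hence `PolyTime` statements can be chained without separate size hypotheses. -/
theorem Runs.size_le {p : Prog} {x y : Data} {t : ℕ} (h : Runs p x y t) :
    x.size ≤ t ∧ y.size ≤ t := by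
  induction h with
  | op o x =>
    have := Nat.le_self_pow (n := 2) (by norm_num) (x.size + (o.eval x).size)
    constructor <;> omega
  | pair _ _ ih₁ ih₂ => simp only [Data.size]; omega
  | comp _ _ ih₁ ih₂ => omega
  | cond_true _ _ _ ih₁ ih₂ => omega
  | cond_false _ _ _ ih₁ ih₂ => omega
  | _ => omega

/-! ## Coding of mathematical objects by trees -/

/-- A type whose elements are coded by trees. -/
class Code (α : Type) where
  code : α → Data

open Code (code)

instance : Code ℤ := ⟨Data.int⟩
instance : Code ℕ := ⟨fun n => Data.int n⟩
instance {α β : Type} [Code α] [Code β] : Code (α × β) := ⟨fun p => .pair (code p.1) (code p.2)⟩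
instance {α : Type} [Code α] : Code (List α) := ⟨fun l => Data.list (l.map code)⟩
instance : Code GaussianInt := ⟨fun z => .pair (.int z.re) (.int z.im)⟩

/-- The size of the tree that codes an object. -/
def codeSize {α : Type} [Code α] (a : α) : ℕ := (code a).size

theorem Runs.loop_of_not_isTrue {c f : Prog} {x b : Data} {s : ℕ} (h : Runs c x b s)
    (hb : ¬ b.IsTrue) : Runs (.loop c f) x x (s + 1) := by
  constructor
  · exact h
  · exact hb

/-- One program computes `f i` from `x i` for all `i`, in time polynomial in the parameter `N i`. -/
def PolyTime {ι α : Type} [Code α] (N : ι → ℕ) (x : ι → Data) (f : ι → α) : Prop :=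
  ∃ (P : Prog) (T : Polynomial ℕ), ∀ i, ∃ t, Runs P (x i) (code (f i)) t ∧ t ≤ T.eval (N i)

/-! ### Closure properties of polynomial-time computability -/

namespace PolyTime

section Basic

variable {ι κ α β γ : Type} [Code α] [Code β] [Code γ] {N : ι → ℕ} {x : ι → Data}

theorem polyBdd_size {f : ι → α} (h : PolyTime N x f) : PolyBdd N fun i => codeSize (f i) := by
  obtain ⟨P, T, h⟩ := h
  refine ⟨T, fun i => ?_⟩
  obtain ⟨t, h₁, h₂⟩ := h i
  exact h₁.size_le.2.trans h₂

/-- Only codes matter, so objects with equal codes are interchangeable: a natural number and its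
integer cast, a nonempty list and the pair of its head and tail. -/
theorem congr_code {f : ι → α} {g : ι → β} (h : PolyTime N x f)
    (hfg : ∀ i, code (f i) = code (g i)) : PolyTime N x g := by
  obtain ⟨P, T, h⟩ := h
  exact ⟨P, T, fun i => hfg i ▸ h i⟩

theorem congr {f g : ι → α} (h : PolyTime N x f) (hfg : ∀ i, f i = g i) : PolyTime N x g :=
  h.congr_code fun i => by rw [hfg i]

theorem mono_param {M : ι → ℕ} {f : ι → α} (h : PolyTime N x f) (hNM : PolyBdd M N) :
    PolyTime M x f := by
  obtain ⟨P, T, h⟩ := h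
  obtain ⟨S, hS⟩ := hNM.poly T
  refine ⟨P, S, fun i => ?_⟩
  obtain ⟨t, h₁, h₂⟩ := h i
  exact ⟨t, h₁, h₂.trans (hS i)⟩

theorem reindex {f : ι → α} (h : PolyTime N x f) (r : κ → ι) :
    PolyTime (fun j => N (r j)) (fun j => x (r j)) fun j => f (r j) := by
  obtain ⟨P, T, h⟩ := h
  exact ⟨P, T, fun j => h (r j)⟩

theorem comp {f : ι → α} {g : ι → β} (hf : PolyTime N x f)
    (hg : PolyTime N (fun i => code (f i)) g) : PolyTime N x g := by
  obtain ⟨P, S, hP⟩ := hf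
  obtain ⟨Q, T, hQ⟩ := hg
  refine ⟨.comp Q P, S + T + 1, fun i => ?_⟩
  obtain ⟨s, h₁, h₂⟩ := hP i
  obtain ⟨t, h₃, h₄⟩ := hQ i
  exact ⟨_, .comp h₁ h₃, by simp; omega⟩

theorem prodMk {f : ι → α} {g : ι → β} (hf : PolyTime N x f) (hg : PolyTime N x g) :
    PolyTime N x fun i => (f i, g i) := by
  obtain ⟨P, S, hP⟩ := hf
  obtain ⟨Q, T, hQ⟩ := hg
  refine ⟨.pair P Q, S + T + 1, fun i => ?_⟩
  obtain ⟨s, h₁, h₂⟩ := hP i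
  obtain ⟨t, h₃, h₄⟩ := hQ i
  exact ⟨_, .pair h₁ h₃, by simp; omega⟩

theorem elementary_of_polyBdd (o : Op) (hx : PolyBdd N fun i => (x i).size) {g : ι → β}
    (hg : ∀ i, o.eval (x i) = code (g i)) : PolyTime N x g := by
  obtain ⟨C, hC⟩ := o.exists_size_eval_le
  obtain ⟨T, hT⟩ := ((hx.add (hx.add (.const C))).pow 2)
  refine ⟨.op o, T, fun i => ⟨_, by rw [← hg i]; exact .op o _, le_trans ?_ (hT i)⟩⟩
  exact Nat.pow_le_pow_left (Nat.add_le_add_left (hC _) _) 2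

/-- Starting point for loop bodies: the index type carries what is promised about the input, and
only its size has to be controlled. -/
theorem input (f : ι → α) (hx : PolyBdd N fun i => codeSize (f i)) :
    PolyTime N (fun i => code (f i)) f :=
  elementary_of_polyBdd .id hx fun _ => rfl

theorem elementary (o : Op) {f : ι → α} {g : ι → β} (hf : PolyTime N x f)
    (hg : ∀ i, o.eval (code (f i)) = code (g i)) : PolyTime N x g :=
  hf.comp (elementary_of_polyBdd o hf.polyBdd_size hg)

theorem fst {f : ι → α × β} (hf : PolyTime N x f) : PolyTime N x fun i => (f i).1 :=
  hf.elementary .fst fun _ => rfl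

theorem snd {f : ι → α × β} (hf : PolyTime N x f) : PolyTime N x fun i => (f i).2 :=
  hf.elementary .snd fun _ => rfl

theorem int_const {f : ι → α} (hf : PolyTime N x f) (z : ℤ) : PolyTime N x fun _ => z :=
  hf.elementary (.const z) fun _ => rfl

theorem add {a b : ι → ℤ} (ha : PolyTime N x a) (hb : PolyTime N x b) :
    PolyTime N x fun i => a i + b i :=
  (ha.prodMk hb).elementary .add fun _ => rfl

theorem sub {a b : ι → ℤ} (ha : PolyTime N x a) (hb : PolyTime N x b) :
    PolyTime N x fun i => a i - b i :=
  (ha.prodMk hb).elementary .sub fun _ => rfl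

theorem mul {a b : ι → ℤ} (ha : PolyTime N x a) (hb : PolyTime N x b) :
    PolyTime N x fun i => a i * b i :=
  (ha.prodMk hb).elementary .mul fun _ => rfl

theorem half {a : ι → ℤ} (ha : PolyTime N x a) : PolyTime N x fun i => a i / 2 :=
  ha.elementary .half fun _ => rfl

theorem ite_pos {c : ι → ℤ} {f g : ι → α} (hc : PolyTime N x c) (hf : PolyTime N x f)
    (hg : PolyTime N x g) : PolyTime N x fun i => if 0 < c i then f i else g i := by
  obtain ⟨P, S, hP⟩ := hc
  obtain ⟨Q, T, hQ⟩ := hf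
  obtain ⟨R, U, hR⟩ := hg
  refine ⟨.cond P Q R, S + T + U + 1, fun i => ?_⟩
  obtain ⟨s, h₁, h₂⟩ := hP i
  obtain ⟨t, h₃, h₄⟩ := hQ i
  obtain ⟨u, h₅, h₆⟩ := hR i
  by_cases h : 0 < c i
  · simp only [h, if_true]
    exact ⟨_, .cond_true h₁ h h₃, by simp; omega⟩
  · simp only [h, if_false]
    exact ⟨_, .cond_false h₁ h h₅, by simp; omega⟩

/-- While-loops with polynomially many rounds, where every test and every round takes polynomial
time. -/
theorem loop {K : ι → ℕ} {st : ι → ℕ → α} {c : ι → ℕ → ℤ} (hK : PolyBdd N K)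
    (hc : PolyTime (fun p : {p : ι × ℕ // p.2 ≤ K p.1} => N p.1.1)
      (fun p => code (st p.1.1 p.1.2)) fun p => c p.1.1 p.1.2)
    (hpos : ∀ i j, j < K i → 0 < c i j) (hend : ∀ i, ¬ 0 < c i (K i))
    (hf : PolyTime (fun p : {p : ι × ℕ // p.2 < K p.1} => N p.1.1)
      (fun p => code (st p.1.1 p.1.2)) fun p => st p.1.1 (p.1.2 + 1)) :
    PolyTime N (fun i => code (st i 0)) fun i => st i (K i) := by
  obtain ⟨P, S, hP⟩ := hc
  obtain ⟨Q, T, hQ⟩ := hf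
  obtain ⟨R, hR⟩ := hK
  refine ⟨.loop P Q, (R + 1) * (S + T + 1), fun i => ?_⟩
  -- Induction on the number `d` of remaining rounds; the test is run once more than the body,
  -- whence `d + 1`.
  have key : ∀ d, ∀ j, j + d = K i → ∃ t, Runs (.loop P Q) (code (st i j)) (code (st i (K i))) t ∧
      t ≤ (d + 1) * (S.eval (N i) + T.eval (N i) + 1) := by
    intro d
    induction d with
    | zero =>
      intro j hj
      obtain rfl : j = K i := by omega
      obtain ⟨s, h₁, h₂⟩ := hP ⟨(i, K i), le_rfl⟩
      exact ⟨_, h₁.loop_of_not_isTrue (hend i), by simp at h₂; simp; omega⟩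
    | succ d ih =>
      intro j hj
      obtain ⟨s, h₁, h₂⟩ := hP ⟨(i, j), by simp; omega⟩
      obtain ⟨t, h₃, h₄⟩ := hQ ⟨(i, j), by simp; omega⟩
      obtain ⟨u, h₅, h₆⟩ := ih (j + 1) (by omega)
      refine ⟨_, .loop_step h₁ (hpos i j (by omega)) h₃ h₅, ?_⟩
      simp only at h₂ h₄
      rw [add_mul (d + 1) 1]
      omega
  obtain ⟨t, h₁, h₂⟩ := key (K i) 0 (by omega)
  refine ⟨t, h₁, h₂.trans ?_⟩
  simp only [Polynomial.eval_mul, Polynomial.eval_add, Polynomial.eval_one]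
  exact Nat.mul_le_mul_right _ (Nat.add_le_add_right (hR i) 1)

end Basic

section Lists

variable {ι α σ ε : Type} [Code α] [Code σ] [Code ε] {N : ι → ℕ} {x : ι → Data}

theorem cons {a : ι → α} {l : ι → List α} (ha : PolyTime N x a) (hl : PolyTime N x l) :
    PolyTime N x fun i => a i :: l i :=
  (ha.prodMk hl).congr_code fun _ => rfl

theorem nil {f : ι → σ} (hf : PolyTime N x f) : PolyTime N x fun _ => ([] : List α) :=
  (hf.int_const 0).congr_code fun _ => rfl

/-- The list is nonempty at every index, so the projection never falls back on its default value. -/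
theorem head_of_cons {a : ι → α} {l : ι → List α} (h : PolyTime N x fun i => a i :: l i) :
    PolyTime N x a :=
  h.elementary .fst fun _ => rfl

theorem tail_of_cons {a : ι → α} {l : ι → List α} (h : PolyTime N x fun i => a i :: l i) :
    PolyTime N x l :=
  h.elementary .snd fun _ => rfl

end Lists

end PolyTime

/-! ### Sizes of the codes of pairs, lists and integers -/

theorem codeSize_prod {α β : Type} [Code α] [Code β] (p : α × β) :
    codeSize p = codeSize p.1 + codeSize p.2 + 1 := rfl

theorem codeSize_list {α : Type} [Code α] (l : List α) :
    codeSize l = (l.map fun a => codeSize a + 1).sum + 2 := by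
  induction l with
  | nil => rfl
  | cons a l ih =>
    have : codeSize (a :: l) = codeSize a + codeSize l + 1 := rfl
    rw [this, ih, List.map_cons, List.sum_cons]
    omega

theorem codeSize_list_le_of_sublist {α : Type} [Code α] {l l' : List α} (h : l.Sublist l') :
    codeSize l ≤ codeSize l' := by
  rw [codeSize_list, codeSize_list]
  exact Nat.add_le_add_right ((h.map _).sum_le_sum fun _ _ => Nat.zero_le _) 2

theorem codeSize_reverse {α : Type} [Code α] (l : List α) : codeSize l.reverse = codeSize l := by
  rw [codeSize_list, codeSize_list, List.map_reverse, List.sum_reverse]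

theorem length_le_codeSize {α : Type} [Code α] (l : List α) : l.length ≤ codeSize l := by
  rw [codeSize_list]
  induction l with
  | nil => simp
  | cons a l ih => simp at ih ⊢; omega

theorem codeSize_list_le {α : Type} [Code α] {l : List α} {b : ℕ}
    (h : ∀ a ∈ l, codeSize a ≤ b) : codeSize l ≤ l.length * (b + 1) + 2 := by
  rw [codeSize_list]
  have := List.sum_le_card_nsmul (l.map fun a => codeSize a + 1) (b + 1) (by
    simpa using fun a ha => h a ha)
  simpa using this

theorem codeSize_int (z : ℤ) : codeSize z = Nat.size z.natAbs + 2 := rfl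

theorem codeSize_int_le {z : ℤ} {b : ℕ} (h : |z| < 2 ^ b) : codeSize z ≤ b + 2 := by
  rw [codeSize_int]
  have : Nat.size z.natAbs ≤ b := by
    rw [Nat.size_le]
    zify
    exact h
  omega

theorem codeSize_nat_le (n : ℕ) : codeSize n ≤ n + 2 := by
  have : Nat.size n ≤ n := by
    rw [Nat.size_le]
    exact Nat.lt_two_pow_self
  change Nat.size (n : ℤ).natAbs + 2 ≤ n + 2
  simpa using this

/-! ### Counted loops and folds over lists -/

namespace PolyTime

section Iteration

variable {ι α σ ε : Type} [Code α] [Code σ] [Code ε] {N : ι → ℕ} {x : ι → Data}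

/-- Iteration of a polynomial-time step, as long as the intermediate results remain small. -/
theorem iterate {K : ι → ℕ} {env : ι → ε} {st : ι → ℕ → σ}
    (hKb : PolyBdd N K) (hsize : PolyBdd (fun p : {p : ι × ℕ // p.2 ≤ K p.1} => N p.1.1)
      fun p => codeSize (st p.1.1 p.1.2))
    (hK : PolyTime N x K) (henv : PolyTime N x env) (hst : PolyTime N x fun i => st i 0)
    (hstep : ∀ y : {p : ι × ℕ // p.2 < K p.1} → Data,
      PolyTime (fun p => N p.1.1) y (fun p => env p.1.1) →
      PolyTime (fun p => N p.1.1) y (fun p => st p.1.1 p.1.2) →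
      PolyTime (fun p => N p.1.1) y (fun p => st p.1.1 (p.1.2 + 1))) :
    PolyTime N x fun i => st i (K i) := by
  -- The loop carries the number of remaining rounds, whose positivity is the loop test.
  let full : ι → ℕ → ℤ × ε × σ := fun i j => ((K i : ℤ) - j, env i, st i j)
  have hfull : PolyBdd (fun p : {p : ι × ℕ // p.2 ≤ K p.1} => N p.1.1)
      fun p => codeSize (full p.1.1 p.1.2) := by
    refine (((hKb.reindex fun p : {p : ι × ℕ // p.2 ≤ K p.1} => p.1.1).add (.const 2)).add
      (((henv.polyBdd_size.reindex fun p : {p : ι × ℕ // p.2 ≤ K p.1} => p.1.1).add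
        hsize).add (.const 2))).mono ?_
    rintro ⟨⟨i, j⟩, hj⟩
    have h := codeSize_nat_le (K i - j)
    have : codeSize ((K i : ℤ) - j) = codeSize (K i - j) := by
      simp only at hj
      rw [← Nat.cast_sub hj]
      rfl
    simp only [full, codeSize_prod, this]
    omega
  have h0 : PolyTime N x fun i => full i 0 :=
    ((hK.congr_code (g := fun i => (K i : ℤ) - (0 : ℕ)) fun i => by
      rw [Nat.cast_zero, sub_zero]; rfl).prodMk (henv.prodMk hst))
  have hid := PolyTime.input (fun p : {p : ι × ℕ // p.2 ≤ K p.1} => full p.1.1 p.1.2) hfull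
  have hid' := hid.reindex fun p : {p : ι × ℕ // p.2 < K p.1} =>
    (⟨p.1, le_of_lt p.2⟩ : {p : ι × ℕ // p.2 ≤ K p.1})
  refine (h0.comp (PolyTime.loop (st := full) (c := fun i j => (K i : ℤ) - j) hKb hid.fst
    (fun i j h => by omega) (fun i => by omega) ?_)).snd.snd
  refine PolyTime.prodMk ((hid'.fst.sub (hid'.int_const 1)).congr fun p => ?_)
    (hid'.snd.fst.prodMk (hstep _ hid'.snd.fst hid'.snd.snd))
  simp only [full]
  push_cast
  ring

/-- Left folds over lists with a polynomial-time step, as long as the intermediate results remain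
small. -/
theorem foldl {env : ι → ε} {L : ι → List α} {s₀ : ι → σ} {step : ε → σ → α → σ}
    (hsize : PolyBdd (fun p : {p : ι × ℕ // p.2 ≤ (L p.1).length} => N p.1.1)
      fun p => codeSize (((L p.1.1).take p.1.2).foldl (step (env p.1.1)) (s₀ p.1.1)))
    (henv : PolyTime N x env) (hL : PolyTime N x L) (hs : PolyTime N x s₀)
    (hstep : ∀ y : {p : ι × ℕ // p.2 < (L p.1).length} → Data,
      PolyTime (fun p => N p.1.1) y (fun p => env p.1.1) →
      PolyTime (fun p => N p.1.1) y
        (fun p => ((L p.1.1).take p.1.2).foldl (step (env p.1.1)) (s₀ p.1.1)) →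
      PolyTime (fun p => N p.1.1) y (fun p => (L p.1.1)[p.1.2]'p.2) →
      PolyTime (fun p => N p.1.1) y fun p =>
        step (env p.1.1) (((L p.1.1).take p.1.2).foldl (step (env p.1.1)) (s₀ p.1.1))
          ((L p.1.1)[p.1.2]'p.2)) :
    PolyTime N x fun i => (L i).foldl (step (env i)) (s₀ i) := by
  let full : ι → ℕ → ε × List α × σ := fun i j =>
    (env i, (L i).drop j, ((L i).take j).foldl (step (env i)) (s₀ i))
  have hfull : PolyBdd (fun p : {p : ι × ℕ // p.2 ≤ (L p.1).length} => N p.1.1)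
      fun p => codeSize (full p.1.1 p.1.2) := by
    let r : {p : ι × ℕ // p.2 ≤ (L p.1).length} → ι := fun p => p.1.1
    refine ((henv.polyBdd_size.reindex r).add
      (((hL.polyBdd_size.reindex r).add hsize).add (.const 2))).mono ?_
    rintro ⟨⟨i, j⟩, hj⟩
    have := codeSize_list_le_of_sublist (List.drop_sublist j (L i))
    simp only [full, codeSize_prod, r]
    omega
  have h0 : PolyTime N x fun i => full i 0 := henv.prodMk (hL.prodMk hs)
  have hid := PolyTime.input
    (fun p : {p : ι × ℕ // p.2 ≤ (L p.1).length} => full p.1.1 p.1.2) hfull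
  have hid' := hid.reindex fun p : {p : ι × ℕ // p.2 < (L p.1).length} =>
    (⟨p.1, le_of_lt p.2⟩ : {p : ι × ℕ // p.2 ≤ (L p.1).length})
  have hcons : PolyTime (fun p : {p : ι × ℕ // p.2 < (L p.1).length} => N p.1.1)
      (fun p => code (full p.1.1 p.1.2))
      (fun p => (L p.1.1)[p.1.2]'p.2 :: (L p.1.1).drop (p.1.2 + 1)) :=
    hid'.snd.fst.congr fun p => List.drop_eq_getElem_cons p.2
  have := (h0.comp (PolyTime.loop (st := full) (K := fun i => (L i).length)
    (c := fun i j => if j < (L i).length then 1 else 0)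
    (hL.polyBdd_size.mono fun i => length_le_codeSize (L i)) ?_ ?_ ?_ ?_)).snd.snd
  · exact this.congr fun i => by simp only [full, List.take_length]
  -- A nonempty list is coded by a pair and the empty list by a leaf, so `isPair` tests whether
  -- elements remain.
  · refine hid.snd.fst.elementary .isPair ?_
    rintro ⟨⟨i, j⟩, hj⟩
    simp only [full]
    split
    · rename_i h
      rw [List.drop_eq_getElem_cons h]
      rfl
    · rename_i h
      rw [List.drop_of_length_le (by omega)]
      rfl
  · intro i j h
    simp [h]
  · intro i
    simp
  · refine hid'.fst.prodMk (hcons.tail_of_cons.prodMk ?_)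
    refine (hstep _ hid'.fst hid'.snd.snd hcons.head_of_cons).congr ?_
    rintro ⟨⟨i, j⟩, hj⟩
    simp only at hj ⊢
    rw [List.take_succ_eq_append_getElem hj, List.foldl_append]
    rfl

/-- Elements moved one by one onto an accumulator arrive in reverse order. Since `splitAt` returns
the initial part reversed, this operation glues a split list together again. -/
theorem reverseAppend {l l' : ι → List α} (hl : PolyTime N x l) (hl' : PolyTime N x l') :
    PolyTime N x fun i => (l i).reverse ++ l' i := by
  have hfold : ∀ a b : List α, a.foldl (fun s c => c :: s) b = a.reverse ++ b := by
    intro a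
    induction a with
    | nil => simp
    | cons c a ih => intro b; simp [ih]
  refine (PolyTime.foldl (env := fun _ => (0 : ℤ)) (step := fun _ s c => c :: s) ?_
    (hl.int_const 0) hl hl' fun y _ hs ha => ha.cons hs).congr fun i => hfold _ _
  refine ((hl.polyBdd_size.add hl'.polyBdd_size).reindex_fst).mono ?_
  rintro ⟨⟨i, j⟩, hj⟩
  simp only [hfold]
  have h1 := codeSize_list_le_of_sublist (List.take_sublist j (l i))
  simp only [codeSize_list, List.map_append, List.sum_append, List.map_reverse,
    List.sum_reverse] at h1 ⊢
  omega

theorem reverse {l : ι → List α} (hl : PolyTime N x l) : PolyTime N x fun i => (l i).reverse :=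
  (hl.reverseAppend hl.nil).congr fun i => by simp

/-- Splitting a list at a given position; the initial part is returned in reverse order. -/
theorem splitAt {l : ι → List α} {p : ι → ℕ} (hl : PolyTime N x l) (hp : PolyTime N x p)
    (hpl : ∀ i, p i ≤ (l i).length) :
    PolyTime N x fun i => ((l i).drop (p i), ((l i).take (p i)).reverse) := by
  refine PolyTime.iterate (env := fun _ => (0 : ℤ)) (K := p)
    (st := fun i j => ((l i).drop j, ((l i).take j).reverse))
    (hl.polyBdd_size.mono fun i => (hpl i).trans (length_le_codeSize _)) ?_ hp (hl.int_const 0)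
    ((hl.prodMk hl.nil).congr fun i => by simp) ?_
  · refine (((hl.polyBdd_size.add hl.polyBdd_size).add (.const 1)).reindex_fst).mono ?_
    rintro ⟨⟨i, j⟩, hj⟩
    have h1 := codeSize_list_le_of_sublist (List.take_sublist j (l i))
    have h2 := codeSize_list_le_of_sublist (List.drop_sublist j (l i))
    simp only [codeSize_prod, codeSize_reverse]
    omega
  · intro y _ hs
    have hlt : ∀ q : {q : ι × ℕ // q.2 < p q.1}, q.1.2 < (l q.1.1).length := fun q =>
      q.2.trans_le (hpl _)
    have hcons : PolyTime (fun q : {q : ι × ℕ // q.2 < p q.1} => N q.1.1) y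
        (fun q => (l q.1.1)[q.1.2]'(hlt q) :: (l q.1.1).drop (q.1.2 + 1)) :=
      hs.fst.congr fun q => List.drop_eq_getElem_cons (hlt q)
    refine hcons.tail_of_cons.prodMk ((hcons.head_of_cons.cons hs.snd).congr ?_)
    rintro ⟨⟨i, j⟩, hj⟩
    have := hlt ⟨⟨i, j⟩, hj⟩
    simp only at this ⊢
    rw [List.take_succ_eq_append_getElem this, List.reverse_append]
    rfl

theorem two_pow {a : ι → ℕ} (hab : PolyBdd N a) (ha : PolyTime N x a) :
    PolyTime N x fun i => (2 : ℤ) ^ a i := by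
  refine PolyTime.iterate (env := fun _ => (0 : ℤ)) (K := a) (st := fun _ j => (2 : ℤ) ^ j)
    hab ?_ ha (ha.int_const 0) (ha.int_const 1) ?_
  · refine ((hab.add (.const 3)).reindex_fst).mono ?_
    rintro ⟨⟨i, j⟩, hj⟩
    refine (codeSize_int_le (b := j + 1) ?_).trans (by simp only at hj ⊢; omega)
    simp only
    rw [abs_of_pos (by positivity)]
    exact pow_lt_pow_right₀ (by norm_num) (by omega)
  · intro y _ hs
    exact (hs.mul (hs.int_const 2)).congr fun p => (pow_succ _ _).symm

/-- Deletion of binary digits. -/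
theorem shiftRight {a : ι → ℕ} {z : ι → ℤ} (hab : PolyBdd N a) (ha : PolyTime N x a)
    (hz : PolyTime N x z) : PolyTime N x fun i => z i / 2 ^ a i := by
  refine PolyTime.iterate (env := fun _ => (0 : ℤ)) (K := a) (st := fun i j => z i / 2 ^ j)
    hab ?_ ha (ha.int_const 0) (hz.congr fun i => by simp) ?_
  · refine (hz.polyBdd_size.reindex_fst).mono ?_
    rintro ⟨⟨i, j⟩, hj⟩
    simp only [codeSize_int]
    refine Nat.add_le_add_right (Nat.size_le_size ?_) 2
    exact Int.natAbs_ediv_le_natAbs _ _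
  · intro y _ hs
    refine hs.half.congr fun p => ?_
    rw [pow_succ, Int.ediv_ediv_of_nonneg (by positivity)]

end Iteration

/-! ### Natural numbers and polynomials in them -/

section Numbers

variable {ι : Type} {N : ι → ℕ} {x : ι → Data}

theorem nat_add {a b : ι → ℕ} (ha : PolyTime N x a) (hb : PolyTime N x b) :
    PolyTime N x fun i => a i + b i :=
  (ha.prodMk hb).elementary .add fun i => by simp [Code.code, Op.eval]

theorem nat_mul {a b : ι → ℕ} (ha : PolyTime N x a) (hb : PolyTime N x b) :
    PolyTime N x fun i => a i * b i :=
  (ha.prodMk hb).elementary .mul fun i => by simp [Code.code, Op.eval]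

theorem nat_const {α : Type} [Code α] {f : ι → α} (hf : PolyTime N x f) (c : ℕ) :
    PolyTime N x fun _ => c :=
  (hf.int_const c).congr_code fun _ => rfl

theorem natCast {a : ι → ℕ} (ha : PolyTime N x a) : PolyTime N x fun i => (a i : ℤ) :=
  ha.congr_code fun _ => rfl

theorem polynomial_eval {a : ι → ℕ} (ha : PolyTime N x a) (T : Polynomial ℕ) :
    PolyTime N x fun i => T.eval (a i) := by
  induction T using Polynomial.induction_on with
  | C c => simpa using ha.nat_const c
  | add p q hp hq => simpa using hp.nat_add hq
  | monomial n c h => simpa [pow_succ, mul_assoc] using h.nat_mul ha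

end Numbers

end PolyTime

/-! ## The simulation algorithm over an arbitrary number system

The observable is a product of two operators that are linear in the fermionic modes.  A mode
operator is given by two coefficients per line; a cell holds, for one line, the amplitudes of the
input state and the coefficients of both factors. -/

/-- The rows of a two-by-two matrix. -/
abbrev Mat2 (R : Type) : Type := (R × R) × (R × R)

/-- The input amplitudes of a line, and the coefficients of two mode operators. -/
abbrev Cell (R : Type) : Type := (R × R) × ((R × R) × (R × R))

section Algorithm

variable {R : Type} [AddCommGroup R] [Star R] (mul : R → R → R) (one : R)

/-- The number `u† V v` for columns `u = (a₀, a₁)` and `v = (b₀, b₁)`. -/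
def sandwich (a₀ a₁ : R) (V : Mat2 R) (b₀ b₁ : R) : R :=
  mul (star a₀) (mul V.1.1 b₀ + mul V.1.2 b₁) + mul (star a₁) (mul V.2.1 b₀ + mul V.2.2 b₁)

/-- The block of a mode operator on two neighbouring lines that maps odd to even parity. -/
def modeBlock (x₀ x₁ : R × R) : Mat2 R := ((x₁.1, x₀.1), (x₀.2, -x₁.2))

/-- The coefficients on two neighbouring lines after conjugation by `G(A,B)`. -/
def rotate (A B : Mat2 R) (x₀ x₁ : R × R) : (R × R) × (R × R) :=
  ((sandwich mul A.1.1 A.2.1 (modeBlock x₀ x₁) B.1.2 B.2.2,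
    sandwich mul A.1.2 A.2.2 (modeBlock x₀ x₁) B.1.1 B.2.1),
   (sandwich mul A.1.1 A.2.1 (modeBlock x₀ x₁) B.1.1 B.2.1,
    -sandwich mul A.1.2 A.2.2 (modeBlock x₀ x₁) B.1.2 B.2.2))

/-- Replacement of the two neighbouring elements of a list from a given position on. -/
def mapPairAt {α : Type} (f : α → α → α × α) : ℕ → List α → List α
  | 0, a :: b :: l => (f a b).1 :: (f a b).2 :: l
  | p + 1, a :: l => a :: mapPairAt f p l
  | _, l => l

/-- The action of a gate on two neighbouring cells. -/
def gateOnCells (A B : Mat2 R) (c d : Cell R) : Cell R × Cell R :=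
  ((c.1, (rotate mul A B c.2.1 d.2.1).1, (rotate mul A B c.2.2 d.2.2).1),
   (d.1, (rotate mul A B c.2.1 d.2.1).2, (rotate mul A B c.2.2 d.2.2).2))

/-- Conjugation by a gate, which is given by its position and two matrices. -/
def applyGate (g : ℕ × Mat2 R × Mat2 R) (L : List (Cell R)) : List (Cell R) :=
  mapPairAt (gateOnCells mul g.2.1 g.2.2) g.1 L

/-- The number `1` if `d = 0`, and `0` otherwise. -/
def indicator (d : ℤ) : R := if 0 < 1 - d * d then one else 0

/-- The cell of a line at distance `d` from the measured line. -/
def initCell (d : ℤ) (s : R × R) : Cell R :=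
  (s, (indicator one d, indicator one d), (-indicator one d, indicator one d))

/-- The cells before any gate is taken into account. -/
def initCells : ℤ → List (R × R) → List (Cell R)
  | _, [] => []
  | d, s :: S => initCell one d s :: initCells (d - 1) S

/-- The contribution of a line to the expectation values of both factors and of their product. -/
def scanStep (c : Cell R) (E : R × R × R) : R × R × R :=
  let u := mul (star c.1.1) c.1.2
  let n₀ := mul (star c.1.1) c.1.1
  let n₁ := mul (star c.1.2) c.1.2
  (mul c.2.1.1 u + mul c.2.1.2 (star u) + mul (n₀ + -n₁) E.1,
   mul c.2.2.1 u + mul c.2.2.2 (star u) + mul (n₀ + -n₁) E.2.1,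
   mul (mul c.2.1.1 c.2.2.2) n₀ + mul (mul c.2.1.2 c.2.2.1) n₁
    + mul (-mul c.2.1.1 u + mul c.2.1.2 (star u)) E.2.1
    + mul (mul c.2.2.1 u + -mul c.2.2.2 (star u)) E.1 + E.2.2)

/-- The cells after all gates have been taken into account. -/
def finalCells (k : ℤ) (G : List (ℕ × Mat2 R × Mat2 R)) (S : List (R × R)) : List (Cell R) :=
  G.foldr (applyGate mul) (initCells one k S)

/-- The result of the simulation. -/
def simulate (k : ℤ) (G : List (ℕ × Mat2 R × Mat2 R)) (S : List (R × R)) : R :=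
  ((finalCells mul one k G S).foldr (scanStep mul) (0, 0, 0)).2.2

end Algorithm

theorem map_mapPairAt {α β : Type} (h : α → β) {f : α → α → α × α} {g : β → β → β × β}
    (hfg : ∀ a b, Prod.map h h (f a b) = g (h a) (h b)) (p : ℕ) (l : List α) :
    (mapPairAt f p l).map h = mapPairAt g p (l.map h) := by
  induction p generalizing l with
  | zero =>
    rcases l with _ | ⟨a, _ | ⟨b, l⟩⟩ <;> simp [mapPairAt, ← hfg]
  | succ p ih =>
    rcases l with _ | ⟨a, l⟩ <;> simp [mapPairAt, ih]

theorem length_mapPairAt {α : Type} (f : α → α → α × α) (p : ℕ) (l : List α) :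
    (mapPairAt f p l).length = l.length := by
  induction p generalizing l with
  | zero => rcases l with _ | ⟨a, _ | ⟨b, l⟩⟩ <;> simp [mapPairAt]
  | succ p ih => rcases l with _ | ⟨a, l⟩ <;> simp [mapPairAt, ih]

/-! ## State vectors, line by line -/

section Slices

variable {w : ℕ}

/-- The part of a vector that belongs to the value `b` of the first line. -/
def slice (b : Fin 2) (v : StateVec (w + 1)) : StateVec w :=
  fun y => v (Fin.cons b y : Basis (w + 1))

theorem slice_add (b : Fin 2) (u v : StateVec (w + 1)) :
    slice b (u + v) = slice b u + slice b v := rfl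

theorem slice_smul (b : Fin 2) (a : ℂ) (v : StateVec (w + 1)) :
    slice b (a • v) = a • slice b v := rfl

theorem ext_slice {u v : StateVec (w + 1)} (h : ∀ b, slice b u = slice b v) : u = v := by
  funext x
  have := congrFun (h (x 0)) (Fin.tail x)
  simpa [slice] using this

theorem sum_basis_succ {M : Type*} [AddCommMonoid M] (f : Basis (w + 1) → M) :
    ∑ x, f x = ∑ b : Fin 2, ∑ y : Basis w, f (Fin.cons b y : Basis (w + 1)) := by
  rw [← (Fin.consEquiv fun _ : Fin (w + 1) => Fin 2).sum_comp, Fintype.sum_prod_type]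
  rfl

theorem slice_productState (b : Fin 2) (φ : Fin (w + 1) → Fin 2 → ℂ) :
    slice b (productState φ) = φ 0 b • productState (Fin.tail φ) := by
  funext y
  simp [slice, productState, Fin.prod_univ_succ, Fin.tail]

/-- The inner product of two state vectors. -/
def ip (u v : StateVec w) : ℂ := star u ⬝ᵥ v

theorem ip_succ (u v : StateVec (w + 1)) :
    ip u v = ip (slice 0 u) (slice 0 v) + ip (slice 1 u) (slice 1 v) := by
  simp [ip, dotProduct, sum_basis_succ, slice, Fin.sum_univ_two]

theorem ip_add_left (u u' v : StateVec w) : ip (u + u') v = ip u v + ip u' v := by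
  simp [ip, add_dotProduct]

theorem ip_add_right (u v v' : StateVec w) : ip u (v + v') = ip u v + ip u v' := by
  simp [ip, dotProduct_add]

theorem ip_smul_left (a : ℂ) (u v : StateVec w) : ip (a • u) v = star a * ip u v := by
  simp [ip, smul_dotProduct]

theorem ip_smul_right (a : ℂ) (u v : StateVec w) : ip u (a • v) = a * ip u v := by
  simp [ip, dotProduct_smul]

theorem slice_onLines_succ (U : Matrix (Fin 2 × Fin 2) (Fin 2 × Fin 2) ℂ) (i j : Fin w)
    (b : Fin 2) (v : StateVec (w + 1)) :
    slice b ((onLines U i.succ j.succ).mulVec v) = (onLines U i j).mulVec (slice b v) := by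
  funext y
  simp only [slice, Matrix.mulVec, dotProduct, sum_basis_succ]
  rw [Finset.sum_eq_single b]
  · refine Finset.sum_congr rfl fun z _ => ?_
    have h : (∀ l, l ≠ i.succ → l ≠ j.succ →
        (Fin.cons b y : Basis (w + 1)) l = (Fin.cons b z : Basis (w + 1)) l) ↔
        ∀ l, l ≠ i → l ≠ j → y l = z l := by
      simp [Fin.forall_fin_succ, (Fin.succ_ne_zero _).symm]
    simp only [onLines, h, Fin.cons_succ]
  · intro c _ hc
    refine Finset.sum_eq_zero fun z _ => ?_
    have : ¬ ∀ l, l ≠ i.succ → l ≠ j.succ →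
        (Fin.cons b y : Basis (w + 1)) l = (Fin.cons c z : Basis (w + 1)) l := by
      intro h
      exact hc (h 0 (Fin.succ_ne_zero _).symm (Fin.succ_ne_zero _).symm).symm
    rw [onLines, if_neg this, zero_mul]
  · simp

theorem slice_onLines_zero (U : Matrix (Fin 2 × Fin 2) (Fin 2 × Fin 2) ℂ)
    (a b : Fin 2) (v : StateVec (w + 2)) :
    slice b (slice a ((onLines U 0 1).mulVec v)) =
      ∑ c : Fin 2, ∑ d : Fin 2, U (a, b) (c, d) • slice d (slice c v) := by
  funext y
  simp only [slice, Matrix.mulVec, dotProduct, sum_basis_succ (w := w + 1), sum_basis_succ (w := w),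
    Finset.sum_apply, Pi.smul_apply, smul_eq_mul]
  refine Finset.sum_congr rfl fun c _ => Finset.sum_congr rfl fun d _ => ?_
  have h : ∀ z : Basis w, (∀ l : Fin (w + 2), l ≠ 0 → l ≠ 1 →
      (Fin.cons a (Fin.cons b y : Basis (w + 1)) : Basis (w + 2)) l =
        (Fin.cons c (Fin.cons d z : Basis (w + 1)) : Basis (w + 2)) l) ↔ y = z := by
    intro z
    constructor
    · intro h
      funext l
      exact h l.succ.succ (Fin.succ_ne_zero _) fun h => Fin.succ_ne_zero l (Fin.succ_injective _ h)
    · rintro rfl l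
      refine Fin.cases (fun h => absurd rfl h) (fun l => ?_) l
      refine Fin.cases (fun _ h => absurd rfl h) (fun l => ?_) l
      exact fun _ _ => rfl
  simp only [onLines, h]
  simp

end Slices

/-! ## Mode operators -/

section Modes

/-- The operator `∑ⱼ Z ⊗ ⋯ ⊗ Z ⊗ (αⱼ |0⟩⟨1| + βⱼ |1⟩⟨0|) ⊗ 1 ⊗ ⋯ ⊗ 1` with coefficients
`(αⱼ, βⱼ)`. -/
noncomputable def modeOp : List (ℂ × ℂ) → ∀ {w : ℕ}, StateVec w → StateVec w
  | [], _, _ => 0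
  | _ :: _, 0, _ => 0
  | x :: L, _ + 1, v => fun b =>
    if b 0 = 0 then x.1 * slice 1 v (Fin.tail b) + modeOp L (slice 0 v) (Fin.tail b)
    else x.2 * slice 0 v (Fin.tail b) - modeOp L (slice 1 v) (Fin.tail b)

variable {w : ℕ}

theorem slice_zero_modeOp (x : ℂ × ℂ) (L : List (ℂ × ℂ)) (v : StateVec (w + 1)) :
    slice 0 (modeOp (x :: L) v) = x.1 • slice 1 v + modeOp L (slice 0 v) := by
  funext y
  simp [slice, modeOp]

theorem slice_one_modeOp (x : ℂ × ℂ) (L : List (ℂ × ℂ)) (v : StateVec (w + 1)) :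
    slice 1 (modeOp (x :: L) v) = x.2 • slice 0 v + (-1 : ℂ) • modeOp L (slice 1 v) := by
  funext y
  simp [slice, modeOp, sub_eq_add_neg]

theorem modeOp_add (L : List (ℂ × ℂ)) (u v : StateVec w) :
    modeOp L (u + v) = modeOp L u + modeOp L v := by
  induction L generalizing w with
  | nil => simp [modeOp]
  | cons x L ih =>
    cases w with
    | zero => simp [modeOp]
    | succ w =>
      refine ext_slice (Fin.forall_fin_two.2 ⟨?_, ?_⟩)
      · simp only [slice_zero_modeOp, slice_add, ih, smul_add]
        abel
      · simp only [slice_one_modeOp, slice_add, ih, smul_add]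
        abel

theorem modeOp_smul (L : List (ℂ × ℂ)) (a : ℂ) (v : StateVec w) :
    modeOp L (a • v) = a • modeOp L v := by
  induction L generalizing w with
  | nil => simp [modeOp]
  | cons x L ih =>
    cases w with
    | zero => simp [modeOp]
    | succ w =>
      refine ext_slice (Fin.forall_fin_two.2 ⟨?_, ?_⟩)
      · simp only [slice_zero_modeOp, slice_smul, ih, smul_add, smul_comm a]
      · simp only [slice_one_modeOp, slice_smul, ih, smul_add, smul_comm a]

theorem modeOp_eq_zero {L : List (ℂ × ℂ)} (hL : ∀ x ∈ L, x = (0, 0)) (v : StateVec w) :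
    modeOp L v = 0 := by
  induction L generalizing w with
  | nil => simp [modeOp]
  | cons x L ih =>
    obtain rfl := hL x (by simp)
    have ih' := fun {w} => ih (fun x hx => hL x (by simp [hx])) (w := w)
    cases w with
    | zero => simp [modeOp]
    | succ w =>
      refine ext_slice (Fin.forall_fin_two.2 ⟨?_, ?_⟩)
      · rw [slice_zero_modeOp, ih']
        simp
        rfl
      · rw [slice_one_modeOp, ih']
        simp
        rfl

/-! ## Gates -/

/-- The gate `G(A,B)` on the lines `p, p + 1`. -/
noncomputable def gateOp (A B : Matrix (Fin 2) (Fin 2) ℂ) (p : ℕ) (hp : p + 1 < w)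
    (v : StateVec w) : StateVec w :=
  (onLines (gab A B) ⟨p, (Nat.lt_succ_self _).trans hp⟩ ⟨p + 1, hp⟩).mulVec v

variable {A B : Matrix (Fin 2) (Fin 2) ℂ}

theorem slice_gateOp_succ (p : ℕ) (hp : p + 1 + 1 < w + 1) (b : Fin 2) (v : StateVec (w + 1)) :
    slice b (gateOp A B (p + 1) hp v) = gateOp A B p (Nat.lt_of_succ_lt_succ hp) (slice b v) :=
  slice_onLines_succ _ ⟨p, _⟩ ⟨p + 1, _⟩ b v

theorem slice_gateOp_zero (hp : 0 + 1 < w + 2) (a b : Fin 2) (v : StateVec (w + 2)) :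
    slice b (slice a (gateOp A B 0 hp v)) =
      if a = b then A a 0 • slice 0 (slice 0 v) + A a 1 • slice 1 (slice 1 v)
      else B a 0 • slice 1 (slice 0 v) + B a 1 • slice 0 (slice 1 v) := by
  refine (slice_onLines_zero (gab A B) a b v).trans ?_
  simp only [Fin.sum_univ_two, gab]
  by_cases h : a = b <;> simp [h]

theorem ext_slice_slice {u v : StateVec (w + 2)}
    (h₀₀ : slice 0 (slice 0 u) = slice 0 (slice 0 v))
    (h₀₁ : slice 1 (slice 0 u) = slice 1 (slice 0 v))
    (h₁₀ : slice 0 (slice 1 u) = slice 0 (slice 1 v))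
    (h₁₁ : slice 1 (slice 1 u) = slice 1 (slice 1 v)) : u = v :=
  ext_slice (Fin.forall_fin_two.2 ⟨ext_slice (Fin.forall_fin_two.2 ⟨h₀₀, h₀₁⟩),
    ext_slice (Fin.forall_fin_two.2 ⟨h₁₀, h₁₁⟩)⟩)

theorem star_mul_entry (hA : A ∈ Matrix.unitaryGroup (Fin 2) ℂ) (i j : Fin 2) :
    star (A 0 i) * A 0 j + star (A 1 i) * A 1 j = if i = j then 1 else 0 := by
  have := congrFun (congrFun (Matrix.mem_unitaryGroup_iff'.1 hA) i) j
  simpa [Matrix.mul_apply, Fin.sum_univ_two, Matrix.one_apply] using this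

/-- Unitarity of the gate: the columns of `A` and `B` are orthonormal on the two parity subspaces.
It cancels a gate on both sides of an expectation value in `expZ_output`, and it preserves total
probability in `ip_output`. -/
theorem ip_gateOp (hA : A ∈ Matrix.unitaryGroup (Fin 2) ℂ) (hB : B ∈ Matrix.unitaryGroup (Fin 2) ℂ)
    (p : ℕ) (hp : p + 1 < w) (u v : StateVec w) :
    ip (gateOp A B p hp u) (gateOp A B p hp v) = ip u v := by
  induction p generalizing w with
  | zero =>
    obtain ⟨w, rfl⟩ := Nat.exists_eq_add_of_le' hp
    rw [ip_succ, ip_succ, ip_succ, ip_succ u, ip_succ (slice 0 u), ip_succ (slice 1 u)]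
    simp only [slice_gateOp_zero]
    have a00 := star_mul_entry hA 0 0
    have a01 := star_mul_entry hA 0 1
    have a10 := star_mul_entry hA 1 0
    have a11 := star_mul_entry hA 1 1
    have b00 := star_mul_entry hB 0 0
    have b01 := star_mul_entry hB 0 1
    have b10 := star_mul_entry hB 1 0
    have b11 := star_mul_entry hB 1 1
    simp only [if_true, zero_ne_one, one_ne_zero, if_false, ip_add_left, ip_add_right,
      ip_smul_left, ip_smul_right] at *
    set u00 := slice 0 (slice 0 u)
    set u01 := slice 1 (slice 0 u)
    set u10 := slice 0 (slice 1 u)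
    set u11 := slice 1 (slice 1 u)
    set v00 := slice 0 (slice 0 v)
    set v01 := slice 1 (slice 0 v)
    set v10 := slice 0 (slice 1 v)
    set v11 := slice 1 (slice 1 v)
    linear_combination ip u00 v00 * a00 + ip u00 v11 * a01 + ip u11 v00 * a10 + ip u11 v11 * a11 +
      ip u01 v01 * b00 + ip u01 v10 * b01 + ip u10 v01 * b10 + ip u10 v10 * b11
  | succ p ih =>
    obtain ⟨w, rfl⟩ := Nat.exists_eq_add_of_le' (Nat.one_le_of_lt hp)
    rw [ip_succ, ip_succ u]
    simp only [slice_gateOp_succ, ih]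

theorem gateOp_add (p : ℕ) (hp : p + 1 < w) (u v : StateVec w) :
    gateOp A B p hp (u + v) = gateOp A B p hp u + gateOp A B p hp v :=
  Matrix.mulVec_add _ _ _

theorem gateOp_smul (p : ℕ) (hp : p + 1 < w) (a : ℂ) (v : StateVec w) :
    gateOp A B p hp (a • v) = a • gateOp A B p hp v :=
  Matrix.mulVec_smul _ _ _

/-- The rows of a matrix. -/
def toMat2 (A : Matrix (Fin 2) (Fin 2) ℂ) : Mat2 ℂ := ((A 0 0, A 0 1), (A 1 0, A 1 1))

/-- Conjugation of a mode operator by a gate on its lines: entries of the even-odd and of the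
odd-even block. -/
theorem rotate_spec (hA : A ∈ Matrix.unitaryGroup (Fin 2) ℂ)
    (hdet : A.det = B.det) (x₀ x₁ : ℂ × ℂ) :
    let y := rotate (· * ·) (toMat2 A) (toMat2 B) x₀ x₁
    A * !![y.2.1, y.1.1; y.1.2, -y.2.2] = !![x₁.1, x₀.1; x₀.2, -x₁.2] * B ∧
      B * !![y.2.2, y.1.1; y.1.2, -y.2.1] = !![x₁.2, x₀.1; x₀.2, -x₁.1] * A := by
  intro y
  have hV : !![y.2.1, y.1.1; y.1.2, -y.2.2] = star A * !![x₁.1, x₀.1; x₀.2, -x₁.2] * B := by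
    ext i j
    fin_cases i <;> fin_cases j <;>
      simp [y, rotate, sandwich, modeBlock, toMat2, Matrix.mul_apply, Fin.sum_univ_two,
        Matrix.star_apply] <;> ring
  have hAA := Matrix.mem_unitaryGroup_iff.1 hA
  have hAA' := Matrix.mem_unitaryGroup_iff'.1 hA
  -- The second block of a mode operator is minus the adjugate of the first block `V`. Adjugates
  -- reverse products, so `A†VB` yields `adj B · adj V · adj A†`. Multiplication by `B` on the left
  -- leaves `adj V · A` times the scalar `det B · det A†`, which is `1` because the determinants
  -- agree.
  have hadj : ∀ a b c d : ℂ, !![a, b; c, -d] = -(!![d, b; c, -a] : Matrix _ _ ℂ).adjugate := by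
    intro a b c d
    rw [Matrix.adjugate_fin_two]
    ext i j
    fin_cases i <;> fin_cases j <;> simp
  constructor
  · rw [hV, mul_assoc, ← mul_assoc, hAA, one_mul]
  · have hstar : (star A).adjugate = (star A).det • A := by
      calc (star A).adjugate = (star A).adjugate * (star A * A) := by rw [hAA', mul_one]
        _ = _ := by rw [← mul_assoc, Matrix.adjugate_mul, smul_mul_assoc, one_mul]
    have hd : B.det * (star A).det = 1 := by
      rw [← hdet, ← Matrix.det_mul, hAA, Matrix.det_one]
    rw [hadj y.2.2, hadj x₁.2, hV, Matrix.adjugate_mul_distrib, Matrix.adjugate_mul_distrib, hstar,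
      mul_neg, ← mul_assoc, Matrix.mul_adjugate, smul_mul_assoc, one_mul, Matrix.mul_smul,
      smul_smul, hd, one_smul, neg_mul]

/-- A mode operator can be moved across a gate. -/
theorem modeOp_gateOp (hA : A ∈ Matrix.unitaryGroup (Fin 2) ℂ)
    (hdet : A.det = B.det) {L : List (ℂ × ℂ)}
    (hL : L.length = w) (p : ℕ) (hp : p + 1 < w) (v : StateVec w) :
    modeOp L (gateOp A B p hp v) =
      gateOp A B p hp (modeOp (mapPairAt (rotate (· * ·) (toMat2 A) (toMat2 B)) p L) v) := by
  induction p generalizing w L with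
  | zero =>
    obtain ⟨w, rfl⟩ := Nat.exists_eq_add_of_le' hp
    obtain _ | ⟨x₀, _ | ⟨x₁, L⟩⟩ := L
    · simp at hL
    · simp at hL
    obtain ⟨h, h'⟩ := rotate_spec hA hdet x₀ x₁
    simp only [mapPairAt]
    set y := rotate (· * ·) (toMat2 A) (toMat2 B) x₀ x₁
    have h00 := congrFun (congrFun h 0) 0
    have h01 := congrFun (congrFun h 0) 1
    have h10 := congrFun (congrFun h 1) 0
    have h11 := congrFun (congrFun h 1) 1
    have h00' := congrFun (congrFun h' 0) 0
    have h01' := congrFun (congrFun h' 0) 1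
    have h10' := congrFun (congrFun h' 1) 0
    have h11' := congrFun (congrFun h' 1) 1
    simp [Matrix.mul_apply, Fin.sum_univ_two] at h00 h01 h10 h11 h00' h01' h10' h11'
    set v00 := slice 0 (slice 0 v) with e00
    set v01 := slice 1 (slice 0 v) with e01
    set v10 := slice 0 (slice 1 v) with e10
    set v11 := slice 1 (slice 1 v) with e11
    apply ext_slice_slice <;>
    · simp only [slice_gateOp_zero, slice_zero_modeOp, slice_one_modeOp, slice_add, slice_smul,
        modeOp_add, modeOp_smul, if_true, zero_ne_one, one_ne_zero, if_false,
        ← e00, ← e01, ← e10, ← e11]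
      funext b
      simp only [Pi.add_apply, Pi.smul_apply, smul_eq_mul]
      -- The terms with the remaining lines `L` cancel: their sign is the parity of the first two
      -- lines, which the gate preserves. What remains is one row of an identity in `rotate_spec`.
      first
      | linear_combination -h00 * v01 b - h01 * v10 b
      | linear_combination -h10 * v01 b - h11 * v10 b
      | linear_combination -h00' * v00 b - h01' * v11 b
      | linear_combination -h10' * v00 b - h11' * v11 b
  | succ p ih =>
    obtain ⟨w, rfl⟩ := Nat.exists_eq_add_of_le' (Nat.one_le_of_lt hp)
    obtain _ | ⟨x, L⟩ := L
    · simp at hL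
    have hL' : L.length = w := by simpa using hL
    refine ext_slice (Fin.forall_fin_two.2 ⟨?_, ?_⟩)
    · simp only [mapPairAt, slice_gateOp_succ, slice_zero_modeOp, ih hL', gateOp_add, gateOp_smul]
    · simp only [mapPairAt, slice_gateOp_succ, slice_one_modeOp, ih hL', gateOp_add, gateOp_smul]

end Modes

/-! ## The exact simulation -/

section Exact

variable {w : ℕ}

/-- The coefficients of the left factor in a list of cells. -/
def leftCoeffs (L : List (Cell ℂ)) : List (ℂ × ℂ) := L.map fun c => c.2.1

/-- The coefficients of the right factor in a list of cells. -/
def rightCoeffs (L : List (Cell ℂ)) : List (ℂ × ℂ) := L.map fun c => c.2.2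

theorem slice_pauliZ_succ (k : Fin w) (b : Fin 2) (v : StateVec (w + 1)) :
    slice b ((pauliZ k.succ).mulVec v) = (pauliZ k).mulVec (slice b v) := by
  funext y
  simp [slice, pauliZ, Matrix.mulVec_diagonal]

theorem slice_pauliZ_zero (b : Fin 2) (v : StateVec (w + 1)) :
    slice b ((pauliZ 0).mulVec v) = (if b = 0 then (1 : ℂ) else -1) • slice b v := by
  funext y
  simp [slice, pauliZ, Matrix.mulVec_diagonal]

theorem initCells_of_neg {d : ℤ} (hd : d < 0) (S : List (ℂ × ℂ)) :
    ∀ c ∈ initCells 1 d S, c.2 = ((0, 0), (0, 0)) := by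
  induction S generalizing d with
  | nil =>
    intro c hc
    cases hc
  | cons s S ih =>
    intro c hc
    have : ¬ 0 < 1 - d * d := by nlinarith
    rcases List.mem_cons.1 hc with rfl | hc
    · simp only [initCell, indicator, if_neg this, neg_zero]
    · exact ih (d := d - 1) (by omega) c hc

/-- On line `k` the factors are |0⟩⟨1| + |1⟩⟨0| and |1⟩⟨0| - |0⟩⟨1|, whose product is `Z`. Before
line `k` the strings meet as `Z² = 1`, and behind it both factors are trivial. -/
theorem modeOp_initCells {S : List (ℂ × ℂ)} (hS : S.length = w) (k : Fin w) (v : StateVec w) :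
    modeOp (leftCoeffs (initCells 1 k S)) (modeOp (rightCoeffs (initCells 1 k S)) v) =
      (pauliZ k).mulVec v := by
  induction S generalizing w with
  | nil => subst hS; exact k.elim0
  | cons s S ih =>
    obtain ⟨w, rfl⟩ : ∃ w', w = w' + 1 := ⟨S.length, by simpa using hS.symm⟩
    have hS' : S.length = w := by simpa using hS
    have hl : ∀ d : ℤ, leftCoeffs (initCells 1 d (s :: S)) =
        (indicator 1 d, indicator 1 d) :: leftCoeffs (initCells 1 (d - 1) S) := fun _ => rfl
    have hr : ∀ d : ℤ, rightCoeffs (initCells 1 d (s :: S)) =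
        (-indicator 1 d, indicator 1 d) :: rightCoeffs (initCells 1 (d - 1) S) := fun _ => rfl
    rw [hl, hr]
    refine Fin.cases ?_ (fun k => ?_) k
    · have h0 := initCells_of_neg (d := ((0 : Fin (w + 1)) : ℕ) - 1) (by simp) S
      have hi : (indicator 1 ((0 : Fin (w + 1)) : ℕ) : ℂ) = 1 := by simp [indicator]
      have hl0 : ∀ v : StateVec w, modeOp (leftCoeffs _) v = 0 := modeOp_eq_zero fun x hx => by
        obtain ⟨c, hc, rfl⟩ := List.mem_map.1 hx
        rw [h0 c hc]
      have hr0 : ∀ v : StateVec w, modeOp (rightCoeffs _) v = 0 := modeOp_eq_zero fun x hx => by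
        obtain ⟨c, hc, rfl⟩ := List.mem_map.1 hx
        rw [h0 c hc]
      rw [hi]
      refine ext_slice (Fin.forall_fin_two.2 ⟨?_, ?_⟩) <;>
        simp only [slice_zero_modeOp, slice_one_modeOp, slice_pauliZ_zero, hl0, hr0] <;> simp
    · have hk : (indicator 1 (k.succ : ℕ) : ℂ) = 0 := by
        rw [indicator, if_neg]
        push_cast [Fin.val_succ]
        nlinarith [k.val.cast_nonneg (α := ℤ)]
      have hd : ((k.succ : ℕ) : ℤ) - 1 = (k : ℕ) := by simp
      rw [hk, hd]
      refine ext_slice (Fin.forall_fin_two.2 ⟨?_, ?_⟩) <;>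
        simp only [slice_zero_modeOp, slice_one_modeOp, slice_pauliZ_succ, modeOp_smul, modeOp_add,
          ih hS'] <;> simp

/-- A gate of a circuit as input of the simulation. -/
def gateData (g : Gate w) : ℕ × Mat2 ℂ × Mat2 ℂ := (g.pos, toMat2 g.A, toMat2 g.B)

theorem toMatrix_mulVec (g : Gate w) (v : StateVec w) :
    g.toMatrix.mulVec v = gateOp g.A g.B g.pos g.pos_lt v := rfl

theorem leftCoeffs_applyGate (g : ℕ × Mat2 ℂ × Mat2 ℂ) (L : List (Cell ℂ)) :
    leftCoeffs (applyGate (· * ·) g L) = mapPairAt (rotate (· * ·) g.2.1 g.2.2) g.1 (leftCoeffs L) :=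
  map_mapPairAt _ (fun _ _ => rfl) _ _

theorem rightCoeffs_applyGate (g : ℕ × Mat2 ℂ × Mat2 ℂ) (L : List (Cell ℂ)) :
    rightCoeffs (applyGate (· * ·) g L) =
      mapPairAt (rotate (· * ·) g.2.1 g.2.2) g.1 (rightCoeffs L) :=
  map_mapPairAt _ (fun _ _ => rfl) _ _

section

variable {R : Type} [AddCommGroup R] (mul : R → R → R) (one : R)

theorem length_initCells (d : ℤ) (S : List (R × R)) : (initCells one d S).length = S.length := by
  induction S generalizing d with
  | nil => rfl
  | cons s S ih => simp [initCells, ih]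

theorem map_fst_initCells (d : ℤ) (S : List (R × R)) :
    (initCells one d S).map Prod.fst = S := by
  induction S generalizing d with
  | nil => rfl
  | cons s S ih => simp [initCells, ih, initCell]

variable [Star R]

theorem length_finalCells (k : ℤ) (G : List (ℕ × Mat2 R × Mat2 R)) (S : List (R × R)) :
    (finalCells mul one k G S).length = S.length := by
  induction G with
  | nil => exact length_initCells one k S
  | cons g G ih => exact (length_mapPairAt _ _ _).trans ih

/-- Gates change coefficients only. On the amplitudes the pair map is `Prod.mk`, which replaces two
entries by themselves, so the final scan still sees the input state. -/
theorem map_fst_finalCells (k : ℤ) (G : List (ℕ × Mat2 R × Mat2 R)) (S : List (R × R)) :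
    (finalCells mul one k G S).map Prod.fst = S := by
  induction G with
  | nil => exact map_fst_initCells one k S
  | cons g G ih =>
    refine (map_mapPairAt Prod.fst (g := Prod.mk) (fun _ _ => rfl) g.1 _).trans ?_
    refine Eq.trans ?_ ih
    have : ∀ (p : ℕ) (l : List (R × R)), mapPairAt Prod.mk p l = l := by
      intro p
      induction p with
      | zero => rintro (_ | ⟨a, _ | ⟨b, l⟩⟩) <;> rfl
      | succ p ih => rintro (_ | ⟨a, l⟩) <;> simp [mapPairAt, ih]
    exact this _ _

end

theorem output_cons (g : Gate w) (C : Circuit w) (v : StateVec w) :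
    Circuit.output (g :: C) v = Circuit.output C (g.toMatrix.mulVec v) := rfl

theorem ip_output (C : Circuit w) (v : StateVec w) :
    ip (C.output v) (C.output v) = ip v v := by
  induction C generalizing v with
  | nil => rfl
  | cons g C ih =>
    rw [output_cons, ih, toMatrix_mulVec, ip_gateOp g.A_unitary g.B_unitary]

/-- Heisenberg picture: both factors are moved across a gate, which then drops out by unitarity. The
observable meets the last gate first, which is why `finalCells` is a right fold. -/
theorem expZ_output {S : List (ℂ × ℂ)} (hS : S.length = w) (k : Fin w) (C : Circuit w)
    (v : StateVec w) :
    let L := finalCells (· * ·) 1 k (C.map gateData) S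
    expZ k (C.output v) = ip v (modeOp (leftCoeffs L) (modeOp (rightCoeffs L) v)) := by
  induction C generalizing v with
  | nil =>
    intro L
    exact congrArg (ip v) (modeOp_initCells hS k v).symm
  | cons g C ih =>
    intro L
    have hlen := (length_finalCells (· * ·) (1 : ℂ) k (C.map gateData) S).trans hS
    have hL : L = applyGate (· * ·) (gateData g)
        (finalCells (· * ·) 1 k (C.map gateData) S) := rfl
    rw [output_cons, ih, toMatrix_mulVec, modeOp_gateOp g.A_unitary g.det_eq (by simpa [rightCoeffs]),
      modeOp_gateOp g.A_unitary g.det_eq (by simpa [leftCoeffs]),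
      ip_gateOp g.A_unitary g.B_unitary, hL, leftCoeffs_applyGate, rightCoeffs_applyGate]
    rfl

/-- The amplitudes of the factors of a product state. -/
def amplitudes (φ : Fin w → Fin 2 → ℂ) : List (ℂ × ℂ) := List.ofFn fun j => (φ j 0, φ j 1)

theorem star_mul_self_add {φ : Fin 2 → ℂ} (h : ‖φ 0‖ ^ 2 + ‖φ 1‖ ^ 2 = 1) :
    star (φ 0) * φ 0 + star (φ 1) * φ 1 = 1 := by
  have : ∀ z : ℂ, star z * z = ((‖z‖ ^ 2 : ℝ) : ℂ) := fun z => by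
    rw [Complex.star_def, Complex.conj_mul']
    push_cast
    rfl
  rw [this, this, ← Complex.ofReal_add, h, Complex.ofReal_one]

theorem ip_productState {φ : Fin w → Fin 2 → ℂ} (hφ : ∀ j, ‖φ j 0‖ ^ 2 + ‖φ j 1‖ ^ 2 = 1) :
    ip (productState φ) (productState φ) = 1 := by
  induction w with
  | zero => simp [ip, productState, dotProduct]
  | succ w ih =>
    have := ih (φ := Fin.tail φ) fun j => hφ j.succ
    rw [ip_succ]
    simp only [slice_productState, ip_smul_left, ip_smul_right, this]
    linear_combination star_mul_self_add (hφ 0)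

/-- The expectation values in a product state can be computed line by line. -/
theorem foldr_scanStep {φ : Fin w → Fin 2 → ℂ} (hφ : ∀ j, ‖φ j 0‖ ^ 2 + ‖φ j 1‖ ^ 2 = 1)
    {L : List (Cell ℂ)} (hL : L.map Prod.fst = amplitudes φ) :
    L.foldr (scanStep (· * ·)) (0, 0, 0) =
      (ip (productState φ) (modeOp (leftCoeffs L) (productState φ)),
        ip (productState φ) (modeOp (rightCoeffs L) (productState φ)),
        ip (productState φ)
          (modeOp (leftCoeffs L) (modeOp (rightCoeffs L) (productState φ)))) := by
  induction w generalizing L with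
  | zero =>
    obtain rfl : L = [] := by simpa [amplitudes] using hL
    simp [leftCoeffs, rightCoeffs, modeOp, ip]
  | succ w ih =>
    obtain _ | ⟨c, L⟩ := L
    · simp [amplitudes] at hL
    have hφ' : ∀ j, ‖Fin.tail φ j 0‖ ^ 2 + ‖Fin.tail φ j 1‖ ^ 2 = 1 := fun j => hφ j.succ
    simp only [amplitudes, List.map_cons, List.ofFn_succ, List.cons.injEq] at hL
    have hip := ip_productState hφ'
    obtain ⟨hc, hL⟩ := hL
    have hl : leftCoeffs (c :: L) = c.2.1 :: leftCoeffs L := rfl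
    have hr : rightCoeffs (c :: L) = c.2.2 :: rightCoeffs L := rfl
    have hn := star_mul_self_add (hφ 0)
    rw [List.foldr_cons, ih hφ' hL, hl, hr]
    simp only [ip_succ (w := w), slice_zero_modeOp, slice_one_modeOp, slice_productState, modeOp_add,
      modeOp_smul, ip_add_right, ip_smul_left, ip_smul_right, hip, scanStep, hc]
    refine Prod.ext ?_ (Prod.ext ?_ ?_)
    · simp
      ring
    · simp
      ring
    · simp
      simp at hn
      -- In the product, the two factors `Z` on this line cancel, so the rest has weight `n₀ + n₁`,
      -- as opposed to `n₀ - n₁` for a single factor. `scanStep` leaves this weight out, as it is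
      -- `1` by normalization.
      linear_combination (-ip (productState (Fin.tail φ)) (modeOp (leftCoeffs L)
        (modeOp (rightCoeffs L) (productState (Fin.tail φ))))) * hn

theorem expZ_eq_simulate (k : Fin w) (C : Circuit w) {φ : Fin w → Fin 2 → ℂ}
    (hφ : ∀ j, ‖φ j 0‖ ^ 2 + ‖φ j 1‖ ^ 2 = 1) :
    expZ k (C.output (productState φ)) =
      simulate (· * ·) 1 k (C.map gateData) (amplitudes φ) := by
  rw [expZ_output (S := amplitudes φ) (by simp [amplitudes]), simulate,
    foldr_scanStep hφ (map_fst_finalCells _ _ _ _ _)]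

theorem expZ_eq_sub (k : Fin w) (ψ : StateVec w) :
    expZ k ψ = ((outcomeProb k 0 ψ - outcomeProb k 1 ψ : ℝ) : ℂ) := by
  rw [expZ, outcomeProb, outcomeProb, ← Finset.sum_sub_distrib, dotProduct, Complex.ofReal_sum]
  refine Finset.sum_congr rfl fun x _ => ?_
  have h := Complex.conj_mul' (ψ x)
  rw [pauliZ, Matrix.mulVec_diagonal, Pi.star_apply, Complex.star_def]
  rcases Fin.exists_fin_two.1 ⟨x k, rfl⟩ with hx | hx
  · simp [h, hx]
  · simp [h, hx]

theorem outcomeProb_add (k : Fin w) (ψ : StateVec w) :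
    ((outcomeProb k 0 ψ + outcomeProb k 1 ψ : ℝ) : ℂ) = ip ψ ψ := by
  rw [ip, outcomeProb, outcomeProb, ← Finset.sum_add_distrib, dotProduct, Complex.ofReal_sum]
  refine Finset.sum_congr rfl fun x _ => ?_
  have h := Complex.conj_mul' (ψ x)
  rw [Pi.star_apply, Complex.star_def, h]
  rcases Fin.exists_fin_two.1 ⟨x k, rfl⟩ with hx | hx
  · simp [hx]
  · simp [hx]

end Exact

/-! ## Fixed-point arithmetic -/

section FixedPoint

/-- Multiplication of fixed-point numbers with `l` binary digits. -/
def fixedMul (l : ℕ) (y z : GaussianInt) : GaussianInt :=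
  ⟨(y * z).re / 2 ^ l, (y * z).im / 2 ^ l⟩

/-- The number `1` with `l` binary digits. -/
def fixedOne (l : ℕ) : GaussianInt := ⟨2 ^ l, 0⟩

/-- The complex number with the fixed-point representation `z`. -/
noncomputable def fixedVal (l : ℕ) (z : GaussianInt) : ℂ := GaussianInt.toComplex z / 2 ^ l

/-- The fixed-point number `z` represents `c` up to `K` units in the last place, and `K` also bounds
the absolute value of `c`. -/
def Near (l : ℕ) (K : ℝ) (c : ℂ) (z : GaussianInt) : Prop :=
  ‖c‖ ≤ K ∧ ‖fixedVal l z - c‖ ≤ K / 2 ^ l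

variable {l : ℕ} {K K' : ℝ} {c c' : ℂ} {y z : GaussianInt}

theorem fixedVal_add (y z : GaussianInt) : fixedVal l (y + z) = fixedVal l y + fixedVal l z := by
  simp [fixedVal, add_div]

theorem fixedVal_neg (z : GaussianInt) : fixedVal l (-z) = -fixedVal l z := by
  simp [fixedVal, neg_div]

theorem fixedVal_star (z : GaussianInt) : fixedVal l (star z) = star (fixedVal l z) := by
  simp [fixedVal, GaussianInt.toComplex_star]

theorem fixedVal_re (z : GaussianInt) : (fixedVal l z).re = z.re / 2 ^ l := by
  have : ((2 : ℂ) ^ l) = ((2 ^ l : ℝ) : ℂ) := by push_cast; rfl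
  rw [fixedVal, this, Complex.div_ofReal_re, GaussianInt.intCast_re]

theorem fixedVal_im (z : GaussianInt) : (fixedVal l z).im = z.im / 2 ^ l := by
  have : ((2 : ℂ) ^ l) = ((2 ^ l : ℝ) : ℂ) := by push_cast; rfl
  rw [fixedVal, this, Complex.div_ofReal_im, GaussianInt.intCast_im]

theorem abs_ediv_two_pow_sub_le (l : ℕ) (X : ℤ) :
    |((X / 2 ^ l : ℤ) : ℝ) - X / 2 ^ l| ≤ 1 := by
  have h := Int.mul_ediv_add_emod X (2 ^ l)
  have h1 := Int.emod_nonneg X (b := 2 ^ l) (by positivity)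
  have h2 := Int.emod_lt_of_pos X (b := 2 ^ l) (by positivity)
  have hX : (X : ℝ) = 2 ^ l * ((X / 2 ^ l : ℤ) : ℝ) + ((X % 2 ^ l : ℤ) : ℝ) := by
    exact_mod_cast h.symm
  have h1' : (0 : ℝ) ≤ ((X % 2 ^ l : ℤ) : ℝ) := by exact_mod_cast h1
  have h2' : ((X % 2 ^ l : ℤ) : ℝ) ≤ 2 ^ l := by exact_mod_cast h2.le
  have hp : (0 : ℝ) < 2 ^ l := by positivity
  have : ((X / 2 ^ l : ℤ) : ℝ) - X / 2 ^ l = -(((X % 2 ^ l : ℤ) : ℝ) / 2 ^ l) := by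
    rw [eq_neg_iff_add_eq_zero]
    field_simp
    linarith
  rw [this, abs_neg, abs_of_nonneg (by positivity)]
  exact (div_le_one hp).2 h2'

/-- Real and imaginary part are each rounded down by at most one unit, hence the constant `2`. -/
theorem norm_fixedVal_mul_sub_le (y z : GaussianInt) :
    ‖fixedVal l (fixedMul l y z) - fixedVal l y * fixedVal l z‖ ≤ 2 / 2 ^ l := by
  have hp : (0 : ℝ) < 2 ^ l := by positivity
  have hm : fixedVal l y * fixedVal l z = fixedVal l (y * z) / 2 ^ l := by
    simp only [fixedVal, map_mul]
    ring
  have h2 : ((2 : ℂ) ^ l) = ((2 ^ l : ℝ) : ℂ) := by push_cast; rfl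
  have key : ∀ X : ℤ, |((X / 2 ^ l : ℤ) : ℝ) / 2 ^ l - X / 2 ^ l / 2 ^ l| ≤ 1 / 2 ^ l := by
    intro X
    rw [← sub_div, abs_div, abs_of_pos hp]
    gcongr
    exact abs_ediv_two_pow_sub_le l X
  refine (Complex.norm_le_abs_re_add_abs_im _).trans ?_
  rw [Complex.sub_re, Complex.sub_im, hm, h2, Complex.div_ofReal_re, Complex.div_ofReal_im]
  simp only [fixedVal_re, fixedVal_im, fixedMul]
  have := add_le_add (key (y * z).re) (key (y * z).im)
  refine this.trans (le_of_eq ?_)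
  ring

namespace Near

theorem mono (h : Near l K c z) (hK : K ≤ K') : Near l K' c z :=
  ⟨h.1.trans hK, h.2.trans (by gcongr)⟩

theorem add (h : Near l K c y) (h' : Near l K' c' z) : Near l (K + K') (c + c') (y + z) := by
  refine ⟨(norm_add_le _ _).trans (add_le_add h.1 h'.1), ?_⟩
  rw [fixedVal_add, add_sub_add_comm, add_div]
  exact (norm_add_le _ _).trans (add_le_add h.2 h'.2)

theorem neg (h : Near l K c z) : Near l K (-c) (-z) := by
  refine ⟨by rw [norm_neg]; exact h.1, ?_⟩
  rw [fixedVal_neg, ← neg_sub', norm_neg]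
  exact h.2

theorem star (h : Near l K c z) : Near l K (star c) (star z) := by
  refine ⟨by rw [norm_star]; exact h.1, ?_⟩
  rw [fixedVal_star, ← star_sub, norm_star]
  exact h.2

theorem zero (hK : 0 ≤ K) : Near l K 0 0 := by
  simp only [Near, fixedVal, map_zero, zero_div, sub_zero, norm_zero]
  exact ⟨hK, by positivity⟩

theorem one : Near l 1 1 (fixedOne l) := by
  have : fixedVal l (fixedOne l) = 1 := by
    have : GaussianInt.toComplex (fixedOne l) = 2 ^ l := by
      simp [fixedOne, GaussianInt.toComplex_def']
    rw [fixedVal, this, div_self (pow_ne_zero l two_ne_zero)]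
  simp [Near, this]

theorem norm_fixedVal_le (h : Near l K c z) : ‖fixedVal l z‖ ≤ 2 * K := by
  have hK : 0 ≤ K := (norm_nonneg _).trans h.1
  have h1 : K / 2 ^ l ≤ K := div_le_self hK (one_le_pow₀ (by norm_num))
  calc ‖fixedVal l z‖ = ‖(fixedVal l z - c) + c‖ := by rw [sub_add_cancel]
    _ ≤ K / 2 ^ l + K := (norm_add_le _ _).trans (add_le_add h.2 h.1)
    _ ≤ 2 * K := by linarith

/-- In units of the last place, the error of the second factor contributes `2KK'` (the computed
first factor is at most `2K`), that of the first contributes `KK'`, and rounding adds `2 ≤ 2KK'`.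
The last estimate is why both bounds must be at least `1`. -/
theorem mul (h : Near l K c y) (h' : Near l K' c' z) (hK : 1 ≤ K) (hK' : 1 ≤ K') :
    Near l (5 * K * K') (c * c') (fixedMul l y z) := by
  have hp : (0 : ℝ) < 2 ^ l := by positivity
  have hKK : 1 ≤ K * K' := one_le_mul_of_one_le_of_one_le hK hK'
  have hn : ‖c * c'‖ ≤ K * K' := by
    rw [norm_mul]
    exact mul_le_mul h.1 h'.1 (norm_nonneg _) (by linarith)
  refine ⟨by linarith, ?_⟩
  have e1 : ‖fixedVal l y * (fixedVal l z - c')‖ ≤ 2 * K * (K' / 2 ^ l) := by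
    rw [norm_mul]
    exact mul_le_mul h.norm_fixedVal_le h'.2 (norm_nonneg _) (by linarith)
  have e2 : ‖(fixedVal l y - c) * c'‖ ≤ K / 2 ^ l * K' := by
    rw [norm_mul]
    exact mul_le_mul h.2 h'.1 (norm_nonneg _) (by positivity)
  have e3 := norm_fixedVal_mul_sub_le (l := l) y z
  calc ‖fixedVal l (fixedMul l y z) - c * c'‖
      = ‖(fixedVal l (fixedMul l y z) - fixedVal l y * fixedVal l z) +
          (fixedVal l y * (fixedVal l z - c') + (fixedVal l y - c) * c')‖ := by
        congr 1
        ring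
    _ ≤ 2 / 2 ^ l + (2 * K * (K' / 2 ^ l) + K / 2 ^ l * K') :=
        (norm_add_le _ _).trans (add_le_add e3 ((norm_add_le _ _).trans (add_le_add e1 e2)))
    _ = (2 + 3 * (K * K')) / 2 ^ l := by ring
    _ ≤ 5 * K * K' / 2 ^ l := by
        gcongr
        linarith

theorem abs_re_le (h : Near l K c z) : |(z.re : ℝ)| ≤ 2 * K * 2 ^ l := by
  have hp : (0 : ℝ) < 2 ^ l := by positivity
  have := (Complex.abs_re_le_norm _).trans h.norm_fixedVal_le
  rwa [fixedVal_re, abs_div, abs_of_pos hp, div_le_iff₀ hp] at this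

theorem abs_im_le (h : Near l K c z) : |(z.im : ℝ)| ≤ 2 * K * 2 ^ l := by
  have hp : (0 : ℝ) < 2 ^ l := by positivity
  have := (Complex.abs_im_le_norm _).trans h.norm_fixedVal_le
  rwa [fixedVal_im, abs_div, abs_of_pos hp, div_le_iff₀ hp] at this

/-- The link between error analysis and running time: being near a number of size at most `2 ^ e`
limits the number of digits. -/
theorem codeSize_le {e : ℕ} (h : Near l (2 ^ e) c z) : codeSize z ≤ 2 * (e + l) + 9 := by
  have key : ∀ X : ℤ, |(X : ℝ)| ≤ 2 * 2 ^ e * 2 ^ l → codeSize X ≤ (e + l + 2) + 2 := by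
    intro X hX
    refine codeSize_int_le ?_
    have : |(X : ℝ)| < 2 ^ (e + l + 2) := by
      refine hX.trans_lt ?_
      rw [pow_add, pow_add]
      have : (0 : ℝ) < 2 ^ e * 2 ^ l := by positivity
      linarith
    exact_mod_cast this
  have h1 := key _ h.abs_re_le
  have h2 := key _ h.abs_im_le
  have : codeSize z = codeSize z.re + codeSize z.im + 1 := rfl
  omega

end Near

/-! ## Error analysis -/

/-- Componentwise approximation of pairs. -/
def NearPair (l : ℕ) (K : ℝ) (c : ℂ × ℂ) (z : GaussianInt × GaussianInt) : Prop :=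
  Near l K c.1 z.1 ∧ Near l K c.2 z.2

/-- Entrywise approximation of matrices. -/
def NearMat (l : ℕ) (K : ℝ) (A : Mat2 ℂ) (B : Mat2 GaussianInt) : Prop :=
  NearPair l K A.1 B.1 ∧ NearPair l K A.2 B.2

/-- Approximation of cells. -/
def NearCell (l : ℕ) (K : ℝ) (c : Cell ℂ) (d : Cell GaussianInt) : Prop :=
  NearPair l 2 c.1 d.1 ∧ NearPair l K c.2.1 d.2.1 ∧ NearPair l K c.2.2 d.2.2

/-- Approximation of gates. -/
def NearGate (l : ℕ) (g : ℕ × Mat2 ℂ × Mat2 ℂ) (h : ℕ × Mat2 GaussianInt × Mat2 GaussianInt) :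
    Prop :=
  g.1 = h.1 ∧ NearMat l 2 g.2.1 h.2.1 ∧ NearMat l 2 g.2.2 h.2.2

theorem NearPair.mono {c z} (h : NearPair l K c z) (hK : K ≤ K') : NearPair l K' c z :=
  ⟨h.1.mono hK, h.2.mono hK⟩

theorem NearCell.mono {c d} (h : NearCell l K c d) (hK : K ≤ K') : NearCell l K' c d :=
  ⟨h.1, h.2.1.mono hK, h.2.2.mono hK⟩

/-- A product of an entry with bound `K` and one with bound `2` has bound `10K`, so a row has `20K`;
the outer products give `200K` each, in total `400K ≤ 2 ^ 9 * K`. -/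
theorem Near.sandwich {a₀ a₁ b₀ b₁ : ℂ} {a₀' a₁' b₀' b₁' : GaussianInt} {V V'}
    (hK : 1 ≤ K) (ha₀ : Near l 2 a₀ a₀') (ha₁ : Near l 2 a₁ a₁') (hV : NearMat l K V V')
    (hb₀ : Near l 2 b₀ b₀') (hb₁ : Near l 2 b₁ b₁') :
    Near l (2 ^ 9 * K) (sandwich (· * ·) a₀ a₁ V b₀ b₁)
      (sandwich (fixedMul l) a₀' a₁' V' b₀' b₁') := by
  have h2 : (1 : ℝ) ≤ 2 := by norm_num
  have r₀ := (hV.1.1.mul hb₀ hK h2).add (hV.1.2.mul hb₁ hK h2)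
  have r₁ := (hV.2.1.mul hb₀ hK h2).add (hV.2.2.mul hb₁ hK h2)
  exact ((ha₀.star.mul r₀ h2 (by linarith)).add (ha₁.star.mul r₁ h2 (by linarith))).mono
    (by linarith)

theorem NearPair.rotate {A B A' B' x₀ x₁ x₀' x₁'} (hK : 1 ≤ K) (hA : NearMat l 2 A A')
    (hB : NearMat l 2 B B') (h₀ : NearPair l K x₀ x₀') (h₁ : NearPair l K x₁ x₁') :
    NearPair l (2 ^ 9 * K) (rotate (· * ·) A B x₀ x₁).1 (rotate (fixedMul l) A' B' x₀' x₁').1 ∧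
    NearPair l (2 ^ 9 * K) (rotate (· * ·) A B x₀ x₁).2 (rotate (fixedMul l) A' B' x₀' x₁').2 := by
  have hV : NearMat l K (modeBlock x₀ x₁) (modeBlock x₀' x₁') :=
    ⟨⟨h₁.1, h₀.1⟩, ⟨h₀.2, h₁.2.neg⟩⟩
  exact ⟨⟨.sandwich hK hA.1.1 hA.2.1 hV hB.1.2 hB.2.2, .sandwich hK hA.1.2 hA.2.2 hV hB.1.1 hB.2.1⟩,
    ⟨.sandwich hK hA.1.1 hA.2.1 hV hB.1.1 hB.2.1,
      (Near.sandwich hK hA.1.2 hA.2.2 hV hB.1.2 hB.2.2).neg⟩⟩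

theorem forall₂_mapPairAt {α β : Type} {R S : α → β → Prop} {f : α → α → α × α}
    {g : β → β → β × β} (hRS : ∀ a b, R a b → S a b)
    (hfg : ∀ a a' b b', R a b → R a' b' → S (f a a').1 (g b b').1 ∧ S (f a a').2 (g b b').2)
    (p : ℕ) {L : List α} {L' : List β} (h : List.Forall₂ R L L') :
    List.Forall₂ S (mapPairAt f p L) (mapPairAt g p L') := by
  induction p generalizing L L' with
  | zero =>
    rcases h with _ | ⟨h₁, _ | ⟨h₂, h⟩⟩
    · exact .nil
    · exact .cons (hRS _ _ h₁) .nil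
    · exact .cons (hfg _ _ _ _ h₁ h₂).1 (.cons (hfg _ _ _ _ h₁ h₂).2 (h.imp hRS))
  | succ p ih =>
    rcases h with _ | ⟨h₁, h⟩
    · exact .nil
    · exact .cons (hRS _ _ h₁) (ih h)

theorem nearCell_applyGate {g h L L'} (hK : 1 ≤ K) (hg : NearGate l g h)
    (hL : List.Forall₂ (NearCell l K) L L') :
    List.Forall₂ (NearCell l (2 ^ 9 * K)) (applyGate (· * ·) g L)
      (applyGate (fixedMul l) h L') := by
  rw [applyGate, applyGate, ← hg.1]
  refine forall₂_mapPairAt (fun _ _ h => h.mono (by linarith)) ?_ _ hL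
  intro a a' b b' hab hab'
  have hx := NearPair.rotate hK hg.2.1 hg.2.2 hab.2.1 hab'.2.1
  have hy := NearPair.rotate hK hg.2.1 hg.2.2 hab.2.2 hab'.2.2
  exact ⟨⟨hab.1, hx.1, hy.1⟩, ⟨hab'.1, hx.2, hy.2⟩⟩

theorem near_indicator (d : ℤ) : Near l 1 (indicator 1 d) (indicator (fixedOne l) d) := by
  rw [indicator, indicator]
  split
  · exact .one
  · exact .zero zero_le_one

theorem nearCell_initCells (d : ℤ) {S S'} (h : List.Forall₂ (NearPair l 2) S S') :
    List.Forall₂ (NearCell l 1) (initCells 1 d S) (initCells (fixedOne l) d S') := by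
  induction h generalizing d with
  | nil => exact .nil
  | cons h _ ih =>
    have hi := near_indicator (l := l) d
    exact .cons ⟨h, ⟨hi, hi⟩, ⟨hi.neg, hi⟩⟩ (ih _)

theorem nearCell_finalCells (k : ℤ) {S S' G G'} (hS : List.Forall₂ (NearPair l 2) S S')
    (hG : List.Forall₂ (NearGate l) G G') :
    List.Forall₂ (NearCell l (2 ^ (9 * G'.length))) (finalCells (· * ·) 1 k G S)
      (finalCells (fixedMul l) (fixedOne l) k G' S') := by
  induction hG with
  | nil => simpa [finalCells] using nearCell_initCells k hS
  | cons hg _ ih =>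
    rw [List.length_cons, Nat.mul_add, mul_one, pow_add, mul_comm]
    exact nearCell_applyGate (one_le_pow₀ (by norm_num)) hg ih

/-- Approximation of the data that are passed from line to line. -/
def NearScan (l : ℕ) (K F : ℝ) (E : ℂ × ℂ × ℂ) (E' : GaussianInt × GaussianInt × GaussianInt) :
    Prop :=
  Near l F E.1 E'.1 ∧ Near l F E.2.1 E'.2.1 ∧ Near l (K * F) E.2.2 E'.2.2

/-- The bound for the product stays of the form `K * F`, without becoming quadratic in `F`, because
each of its terms contains at most one expectation value of the remaining lines. Each line therefore
costs a constant factor. -/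
theorem nearScan_scanStep {F : ℝ} {c d E E'} (hK : 1 ≤ K) (hKF : K ≤ F)
    (hc : NearCell l K c d) (hE : NearScan l K F E E') :
    NearScan l K (2 ^ 12 * F) (scanStep (· * ·) c E) (scanStep (fixedMul l) d E') := by
  obtain ⟨hφ, hx, hy⟩ := hc
  obtain ⟨h₁, h₂, h₃⟩ := hE
  have t2 : (1 : ℝ) ≤ 2 := by norm_num
  have hF : 1 ≤ F := hK.trans hKF
  have hu := (hφ.1.star.mul hφ.2 t2 t2).mono (K' := 20) (by norm_num)
  have h₀ := (hφ.1.star.mul hφ.1 t2 t2).mono (K' := 20) (by norm_num)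
  have h₁' := (hφ.2.star.mul hφ.2 t2 t2).mono (K' := 20) (by norm_num)
  have hz := (h₀.add h₁'.neg).mono (K' := 40) (by norm_num)
  have t20 : (1 : ℝ) ≤ 20 := by norm_num
  have t40 : (1 : ℝ) ≤ 40 := by norm_num
  have hKF2 : K * K ≤ K * F := mul_le_mul_of_nonneg_left hKF (by linarith)
  have hKF1 : 1 ≤ K * F := one_le_mul_of_one_le_of_one_le hK hF
  have hKK1 : 1 ≤ K * K := one_le_mul_of_one_le_of_one_le hK hK
  refine ⟨?_, ?_, ?_⟩
  · exact (((hx.1.mul hu hK t20).add (hx.2.mul hu.star hK t20)).add (hz.mul h₁ t40 hF)).mono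
      (by linarith)
  · exact (((hy.1.mul hu hK t20).add (hy.2.mul hu.star hK t20)).add (hz.mul h₂ t40 hF)).mono
      (by linarith)
  · have a₁ := ((hx.1.mul hy.2 hK hK).mono (K' := 5 * (K * K)) (by linarith)).mul h₀
      (by linarith) t20
    have a₂ := ((hx.2.mul hy.1 hK hK).mono (K' := 5 * (K * K)) (by linarith)).mul h₁'
      (by linarith) t20
    have a₃ := (((hx.1.mul hu hK t20).neg.add (hx.2.mul hu.star hK t20)).mono
      (K' := 200 * K) (by linarith)).mul h₂ (by linarith) hF
    have a₄ := (((hy.1.mul hu hK t20).add (hy.2.mul hu.star hK t20).neg).mono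
      (K' := 200 * K) (by linarith)).mul h₁ (by linarith) hF
    -- The bounds are `500K²` twice, `1000KF` twice and `KF`; with `K ≤ F` the sum is at most
    -- `3001KF ≤ 2 ^ 12 * KF`.
    exact ((((a₁.add a₂).add a₃).add a₄).add h₃).mono (by linarith)

theorem nearScan_foldr (hK : 1 ≤ K) {L L'} (hL : List.Forall₂ (NearCell l K) L L') :
    NearScan l K (2 ^ (12 * L'.length) * K) (L.foldr (scanStep (· * ·)) (0, 0, 0))
      (L'.foldr (scanStep (fixedMul l)) (0, 0, 0)) := by
  induction hL with
  | nil =>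
    exact ⟨.zero (by positivity), .zero (by positivity), .zero (by positivity)⟩
  | @cons _ _ _ l' hc _ ih =>
    rw [List.length_cons, Nat.mul_add, mul_one, pow_add, mul_comm (2 ^ _), mul_assoc]
    exact nearScan_scanStep hK (le_mul_of_one_le_left (by linarith) (one_le_pow₀ (by norm_num)))
      hc ih

/-- The bound is `K * F`, where the coefficients give `9` per gate in the exponent of `K`, and `F`
has `12` per line in addition to the exponent of `K`. -/
theorem near_simulate (k : ℤ) {S S' G G'} (hS : List.Forall₂ (NearPair l 2) S S')
    (hG : List.Forall₂ (NearGate l) G G') :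
    Near l (2 ^ (18 * G'.length + 12 * S'.length)) (simulate (· * ·) 1 k G S)
      (simulate (fixedMul l) (fixedOne l) k G' S') := by
  have := (nearScan_foldr (one_le_pow₀ (by norm_num)) (nearCell_finalCells k hS hG)).2.2
  rw [length_finalCells] at this
  refine this.mono (le_of_eq ?_)
  rw [← pow_add, ← pow_add]
  congr 1
  ring

end FixedPoint

/-! ## The simulation algorithm runs in polynomial time -/

namespace PolyTime

section Arithmetic

variable {ι : Type} {N : ι → ℕ} {x : ι → Data} {y z : ι → GaussianInt}

theorem re (hz : PolyTime N x z) : PolyTime N x fun i => (z i).re :=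
  hz.elementary .fst fun _ => rfl

theorem im (hz : PolyTime N x z) : PolyTime N x fun i => (z i).im :=
  hz.elementary .snd fun _ => rfl

theorem gaussian_of_re_im (hr : PolyTime N x fun i => (z i).re) (hi : PolyTime N x fun i => (z i).im) :
    PolyTime N x z :=
  (hr.prodMk hi).congr_code fun _ => rfl

theorem int_neg {a : ι → ℤ} (ha : PolyTime N x a) : PolyTime N x fun i => -a i :=
  ((ha.int_const 0).sub ha).congr fun _ => zero_sub _

theorem gaussian_add (hy : PolyTime N x y) (hz : PolyTime N x z) :
    PolyTime N x fun i => y i + z i :=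
  gaussian_of_re_im ((hy.re.add hz.re).congr fun _ => rfl) ((hy.im.add hz.im).congr fun _ => rfl)

theorem gaussian_neg (hz : PolyTime N x z) : PolyTime N x fun i => -z i :=
  gaussian_of_re_im (hz.re.int_neg.congr fun _ => rfl) (hz.im.int_neg.congr fun _ => rfl)

theorem gaussian_star (hz : PolyTime N x z) : PolyTime N x fun i => star (z i) :=
  gaussian_of_re_im (hz.re.congr fun _ => rfl) (hz.im.int_neg.congr fun _ => rfl)

theorem gaussian_zero {α : Type} [Code α] {f : ι → α} (hf : PolyTime N x f) :
    PolyTime N x fun _ => (0 : GaussianInt) :=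
  gaussian_of_re_im (hf.int_const 0) (hf.int_const 0)

theorem gaussian_mul (hy : PolyTime N x y) (hz : PolyTime N x z) :
    PolyTime N x fun i => y i * z i := by
  refine gaussian_of_re_im (((hy.re.mul hz.re).sub (hy.im.mul hz.im)).congr fun _ => ?_)
    (((hy.re.mul hz.im).add (hy.im.mul hz.re)).congr fun _ => ?_)
  · simp [sub_eq_add_neg]
  · simp

variable {l : ι → ℕ}

theorem fixedMul (hlb : PolyBdd N l) (hl : PolyTime N x l) (hy : PolyTime N x y)
    (hz : PolyTime N x z) : PolyTime N x fun i => fixedMul (l i) (y i) (z i) :=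
  gaussian_of_re_im (shiftRight hlb hl (hy.gaussian_mul hz).re)
    (shiftRight hlb hl (hy.gaussian_mul hz).im)

theorem fixedOne (hlb : PolyBdd N l) (hl : PolyTime N x l) :
    PolyTime N x fun i => fixedOne (l i) :=
  gaussian_of_re_im (two_pow hlb hl) (hl.int_const 0)

theorem sandwich {a₀ a₁ b₀ b₁ : ι → GaussianInt} {V : ι → Mat2 GaussianInt}
    (hlb : PolyBdd N l) (hl : PolyTime N x l)
    (ha₀ : PolyTime N x a₀) (ha₁ : PolyTime N x a₁) (hV : PolyTime N x V) (hb₀ : PolyTime N x b₀)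
    (hb₁ : PolyTime N x b₁) :
    PolyTime N x fun i => sandwich (Matchgate.fixedMul (l i)) (a₀ i) (a₁ i) (V i) (b₀ i) (b₁ i) := by
  have m {y z : ι → GaussianInt} (hy : PolyTime N x y) (hz : PolyTime N x z) :=
    fixedMul hlb hl hy hz
  exact (m ha₀.gaussian_star ((m hV.fst.fst hb₀).gaussian_add (m hV.fst.snd hb₁))).gaussian_add
    (m ha₁.gaussian_star ((m hV.snd.fst hb₀).gaussian_add (m hV.snd.snd hb₁)))

theorem rotate {A B : ι → Mat2 GaussianInt} {x₀ x₁ : ι → GaussianInt × GaussianInt}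
    (hlb : PolyBdd N l) (hl : PolyTime N x l) (hA : PolyTime N x A) (hB : PolyTime N x B)
    (h₀ : PolyTime N x x₀) (h₁ : PolyTime N x x₁) :
    PolyTime N x fun i => rotate (Matchgate.fixedMul (l i)) (A i) (B i) (x₀ i) (x₁ i) := by
  have hV : PolyTime N x fun i => modeBlock (x₀ i) (x₁ i) :=
    (h₁.fst.prodMk h₀.fst).prodMk (h₀.snd.prodMk h₁.snd.gaussian_neg)
  exact ((sandwich hlb hl hA.fst.fst hA.snd.fst hV hB.fst.snd hB.snd.snd).prodMk
    (sandwich hlb hl hA.fst.snd hA.snd.snd hV hB.fst.fst hB.snd.fst)).prodMk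
    ((sandwich hlb hl hA.fst.fst hA.snd.fst hV hB.fst.fst hB.snd.fst).prodMk
    (sandwich hlb hl hA.fst.snd hA.snd.snd hV hB.fst.snd hB.snd.snd).gaussian_neg)

theorem gateOnCells {A B : ι → Mat2 GaussianInt} {c d : ι → Cell GaussianInt}
    (hlb : PolyBdd N l) (hl : PolyTime N x l) (hA : PolyTime N x A) (hB : PolyTime N x B)
    (hc : PolyTime N x c) (hd : PolyTime N x d) :
    PolyTime N x fun i => gateOnCells (Matchgate.fixedMul (l i)) (A i) (B i) (c i) (d i) := by
  have hx := rotate hlb hl hA hB hc.snd.fst hd.snd.fst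
  have hy := rotate hlb hl hA hB hc.snd.snd hd.snd.snd
  exact (hc.fst.prodMk (hx.fst.prodMk hy.fst)).prodMk (hd.fst.prodMk (hx.snd.prodMk hy.snd))

theorem scanStep {c : ι → Cell GaussianInt} {E : ι → GaussianInt × GaussianInt × GaussianInt}
    (hlb : PolyBdd N l) (hl : PolyTime N x l) (hc : PolyTime N x c) (hE : PolyTime N x E) :
    PolyTime N x fun i => scanStep (Matchgate.fixedMul (l i)) (c i) (E i) := by
  have m {y z : ι → GaussianInt} (hy : PolyTime N x y) (hz : PolyTime N x z) :=
    fixedMul hlb hl hy hz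
  have u := m hc.fst.fst.gaussian_star hc.fst.snd
  have n₀ := m hc.fst.fst.gaussian_star hc.fst.fst
  have n₁ := m hc.fst.snd.gaussian_star hc.fst.snd
  have zz := n₀.gaussian_add n₁.gaussian_neg
  have x₁ := hc.snd.fst.fst
  have x₂ := hc.snd.fst.snd
  have y₁ := hc.snd.snd.fst
  have y₂ := hc.snd.snd.snd
  exact (((m x₁ u).gaussian_add (m x₂ u.gaussian_star)).gaussian_add (m zz hE.fst)).prodMk
    ((((m y₁ u).gaussian_add (m y₂ u.gaussian_star)).gaussian_add (m zz hE.snd.fst)).prodMk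
    (((((m (m x₁ y₂) n₀).gaussian_add (m (m x₂ y₁) n₁)).gaussian_add
      (m ((m x₁ u).gaussian_neg.gaussian_add (m x₂ u.gaussian_star)) hE.snd.fst)).gaussian_add
      (m ((m y₁ u).gaussian_add (m y₂ u.gaussian_star).gaussian_neg) hE.fst)).gaussian_add
      hE.snd.snd))

end Arithmetic

end PolyTime

/-! ### Replacing two neighbouring entries by splitting the list -/

theorem mapPairAt_append {α : Type} (f : α → α → α × α) (p : List α) (a b : α) (l : List α) :
    mapPairAt f p.length (p ++ a :: b :: l) = p ++ (f a b).1 :: (f a b).2 :: l := by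
  induction p with
  | nil => rfl
  | cons c p ih => simp [mapPairAt, ih]

theorem drop_eq_getElem_cons_cons {α : Type} {l : List α} {p : ℕ} (h : p + 1 < l.length) :
    l.drop p = l[p] :: l[p + 1] :: l.drop (p + 2) := by
  rw [List.drop_eq_getElem_cons (by omega), List.drop_eq_getElem_cons h]

theorem mapPairAt_eq {α : Type} (f : α → α → α × α) {l : List α} {p : ℕ} (h : p + 1 < l.length) :
    mapPairAt f p l =
      l.take p ++ (f l[p] l[p + 1]).1 :: (f l[p] l[p + 1]).2 :: l.drop (p + 2) := by
  have h1 := mapPairAt_append f (l.take p) l[p] l[p + 1] (l.drop (p + 2))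
  rwa [← drop_eq_getElem_cons_cons h, List.take_append_drop, List.length_take,
    min_eq_left (by omega)] at h1

namespace PolyTime

variable {ι : Type} {N : ι → ℕ} {x : ι → Data} {l : ι → ℕ}

theorem applyGate {g : ι → ℕ × Mat2 GaussianInt × Mat2 GaussianInt}
    {L : ι → List (Cell GaussianInt)} (hlb : PolyBdd N l) (hl : PolyTime N x l)
    (hg : PolyTime N x g) (hL : PolyTime N x L) (hgL : ∀ i, (g i).1 + 1 < (L i).length) :
    PolyTime N x fun i => applyGate (Matchgate.fixedMul (l i)) (g i) (L i) := by
  have hs := hL.splitAt hg.fst fun i => by have := hgL i; omega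
  have hd := hs.fst.congr fun i => drop_eq_getElem_cons_cons (hgL i)
  have hr := gateOnCells hlb hl hg.snd.fst hg.snd.snd hd.head_of_cons hd.tail_of_cons.head_of_cons
  refine (hs.snd.reverseAppend (hr.fst.cons (hr.snd.cons hd.tail_of_cons.tail_of_cons))).congr
    fun i => ?_
  rw [List.reverse_reverse, Matchgate.applyGate, mapPairAt_eq _ (hgL i)]

theorem initCell {k : ι → ℤ} {one : ι → GaussianInt} {s : ι → GaussianInt × GaussianInt}
    (hone : PolyTime N x one) (hk : PolyTime N x k) (hs : PolyTime N x s) :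
    PolyTime N x fun i => initCell (one i) (k i) (s i) := by
  have hi : PolyTime N x fun i => indicator (one i) (k i) :=
    ite_pos ((hk.int_const 1).sub (hk.mul hk)) hone hk.gaussian_zero
  exact hs.prodMk ((hi.prodMk hi).prodMk (hi.gaussian_neg.prodMk hi))

end PolyTime

theorem codeSize_neg (z : GaussianInt) : codeSize (-z) = codeSize z := by
  change codeSize (-z.re) + codeSize (-z.im) + 1 = codeSize z.re + codeSize z.im + 1
  simp only [codeSize_int, Int.natAbs_neg]

theorem codeSize_initCells_le (one : GaussianInt) (d : ℤ) (S : List (GaussianInt × GaussianInt)) :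
    codeSize (initCells one d S) ≤ codeSize S + S.length * (4 * codeSize one + 24) := by
  induction S generalizing d with
  | nil => exact Nat.le_add_right _ _
  | cons s S ih =>
    have h1 : codeSize (initCells one d (s :: S)) =
        codeSize (initCell one d s) + codeSize (initCells one (d - 1) S) + 1 := rfl
    have h2 : codeSize (s :: S) = codeSize s + codeSize S + 1 := rfl
    have h3 : codeSize (indicator one d) ≤ codeSize one + 5 := by
      rw [indicator]
      split
      · omega
      · exact Nat.le_add_left _ _
    have h4 := ih (d - 1)
    rw [h1, h2, List.length_cons, add_mul, one_mul, initCell]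
    simp only [codeSize_prod, codeSize_neg]
    omega

namespace PolyTime

variable {ι : Type} {N : ι → ℕ} {x : ι → Data} {l : ι → ℕ}

theorem initCells {k : ι → ℤ} {one : ι → GaussianInt} {S : ι → List (GaussianInt × GaussianInt)}
    (hone : PolyTime N x one) (hk : PolyTime N x k) (hS : PolyTime N x S) :
    PolyTime N x fun i => initCells (one i) (k i) (S i) := by
  let step : GaussianInt → ℤ × List (Cell GaussianInt) → GaussianInt × GaussianInt →
      ℤ × List (Cell GaussianInt) := fun one s a => (s.1 - 1, Matchgate.initCell one s.1 a :: s.2)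
  have hfold : ∀ (one : GaussianInt) (S : List (GaussianInt × GaussianInt)) (d : ℤ)
      (acc : List (Cell GaussianInt)), S.foldl (step one) (d, acc) =
        (d - S.length, (Matchgate.initCells one d S).reverse ++ acc) := by
    intro one S
    induction S with
    | nil => intro d acc; simp [Matchgate.initCells]
    | cons s S ih =>
      intro d acc
      rw [List.foldl_cons, ih]
      simp only [Matchgate.initCells, List.length_cons, List.reverse_cons, List.append_assoc]
      refine Prod.ext ?_ rfl
      push_cast
      ring
  have := PolyTime.foldl (env := one) (L := S) (s₀ := fun i => (k i, [])) (step := step) ?_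
    hone hS (hk.prodMk hk.nil) fun y he hs ha =>
      (hs.fst.sub (hs.int_const 1)).prodMk ((initCell he hs.fst ha).cons hs.snd)
  · refine this.snd.reverse.congr fun i => ?_
    simp [hfold]
  · have hlen : PolyBdd N fun i => (S i).length :=
      hS.polyBdd_size.mono fun i => length_le_codeSize (S i)
    refine ((((hk.polyBdd_size.add hlen).add hS.polyBdd_size).add
      (hlen.mul (((PolyBdd.const 4).mul hone.polyBdd_size).add (.const 24)))).add
        (.const 5)).reindex_fst.mono ?_
    rintro ⟨⟨i, j⟩, hj⟩
    have h1 := codeSize_initCells_le (one i) (k i) ((S i).take j)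
    have h2 := codeSize_list_le_of_sublist (List.take_sublist j (S i))
    have h3 : ((S i).take j).length ≤ (S i).length := by simp
    have h4 := Nat.mul_le_mul_right (4 * codeSize (one i) + 24) h3
    have h5 := natSize_natAbs_add_le (k i) (-(((S i).take j).length : ℤ))
    have h6 := codeSize_nat_le ((S i).take j).length
    have h7 : codeSize ((S i).take j).length =
      Nat.size (-(((S i).take j).length : ℤ)).natAbs + 2 := by rw [Int.natAbs_neg]; rfl
    simp only [hfold, List.append_nil, codeSize_prod, codeSize_reverse, codeSize_int,
      sub_eq_add_neg] at *
    omega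

/-- Right folds over lists with a polynomial-time step, as long as the intermediate results remain
small. -/
theorem foldr {α σ ε : Type} [Code α] [Code σ] [Code ε] {env : ι → ε} {L : ι → List α}
    {s₀ : ι → σ} {step : ε → α → σ → σ}
    (hsize : PolyBdd (fun p : ι × ℕ => N p.1)
      fun p => codeSize (((L p.1).drop p.2).foldr (step (env p.1)) (s₀ p.1)))
    (henv : PolyTime N x env) (hL : PolyTime N x L) (hs : PolyTime N x s₀)
    (hstep : ∀ {κ : Type} (r : κ → ι) (j : κ → ℕ) (hj : ∀ p, j p < (L (r p)).length)
      (y : κ → Data), PolyTime (fun p => N (r p)) y (fun p => env (r p)) →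
      PolyTime (fun p => N (r p)) y
        (fun p => ((L (r p)).drop (j p + 1)).foldr (step (env (r p))) (s₀ (r p))) →
      PolyTime (fun p => N (r p)) y (fun p => (L (r p))[j p]'(hj p)) →
      PolyTime (fun p => N (r p)) y fun p => step (env (r p)) ((L (r p))[j p]'(hj p))
        (((L (r p)).drop (j p + 1)).foldr (step (env (r p))) (s₀ (r p)))) :
    PolyTime N x fun i => (L i).foldr (step (env i)) (s₀ i) := by
  -- A right fold is a left fold over the reversed list, and `j` rounds of it process the last `j`
  -- elements.
  have key : ∀ i j, ((L i).reverse.take j).foldl (fun s a => step (env i) a s) (s₀ i) =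
      ((L i).drop ((L i).length - j)).foldr (step (env i)) (s₀ i) := fun i j => by
    rw [List.take_reverse, List.foldl_reverse]
  refine (PolyTime.foldl (step := fun e s a => step e a s) ?_ henv hL.reverse hs ?_).congr
    fun i => List.foldl_reverse
  · obtain ⟨T, hT⟩ := hsize
    exact ⟨T, fun p => by simpa only [key] using hT (p.1.1, (L p.1.1).length - p.1.2)⟩
  · intro y he hf ha
    have hlt : ∀ p : {p : ι × ℕ // p.2 < (L p.1).reverse.length},
        p.1.2 < (L p.1.1).length := fun p => by simpa using p.2
    have hidx : ∀ p : {p : ι × ℕ // p.2 < (L p.1).reverse.length},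
        (L p.1.1).length - 1 - p.1.2 + 1 = (L p.1.1).length - p.1.2 := fun p => by
      have := hlt p
      omega
    have := hstep (κ := {p : ι × ℕ // p.2 < (L p.1).reverse.length}) (fun p => p.1.1)
      (fun p => (L p.1.1).length - 1 - p.1.2) (fun p => by have := hlt p; omega) y he
      (hf.congr fun p => by simp only [key, hidx])
      (ha.congr fun p => by rw [List.getElem_reverse])
    refine this.congr fun p => ?_
    simp only [key, hidx, List.getElem_reverse]

end PolyTime

/-! ### Code sizes from approximation bounds -/

theorem NearCell.codeSize_le {l e : ℕ} {c : Cell ℂ} {d : Cell GaussianInt}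
    (h : NearCell l (2 ^ e) c d) : codeSize d ≤ 12 * (e + l) + 80 := by
  have h2 : (2 : ℝ) ≤ 2 ^ (e + 1) := by
    rw [pow_succ]
    linarith [one_le_pow₀ (M₀ := ℝ) (a := 2) (n := e) (by norm_num)]
  have h1 := (h.1.1.mono h2).codeSize_le
  have h1' := (h.1.2.mono h2).codeSize_le
  have h3 := h.2.1.1.codeSize_le
  have h4 := h.2.1.2.codeSize_le
  have h5 := h.2.2.1.codeSize_le
  have h6 := h.2.2.2.codeSize_le
  simp only [codeSize_prod]
  omega

theorem NearScan.codeSize_le {l e f : ℕ} {E E'} (h : NearScan l (2 ^ e) (2 ^ f) E E') :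
    codeSize E' ≤ 6 * (e + f + l) + 40 := by
  have h1 := h.1.codeSize_le
  have h2 := h.2.1.codeSize_le
  have h3 := h.2.2
  rw [← pow_add] at h3
  have h3' := h3.codeSize_le
  simp only [codeSize_prod]
  omega

theorem forall_codeSize_le_of_forall₂ {l e : ℕ} {L L'}
    (h : List.Forall₂ (NearCell l (2 ^ e)) L L') : ∀ d ∈ L', codeSize d ≤ 12 * (e + l) + 80 := by
  induction h with
  | nil => simp
  | cons h _ ih =>
    intro d hd
    rcases List.mem_cons.1 hd with rfl | hd
    · exact h.codeSize_le
    · exact ih d hd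

namespace PolyTime

variable {ι : Type} {N : ι → ℕ} {x : ι → Data} {l : ι → ℕ}

section

variable {k : ι → ℤ} {G : ι → List (ℕ × Mat2 GaussianInt × Mat2 GaussianInt)}
  {S : ι → List (GaussianInt × GaussianInt)}

/-- The intermediate cells stay short because they approximate exact ones of size at most `2 ^ e`,
with `e` growing by `9` per gate. `hGn` and `hSn` provide exact data for this comparison; they play
no part in the computation. -/
theorem finalCells (hlb : PolyBdd N l) (hl : PolyTime N x l) (hk : PolyTime N x k)
    (hG : PolyTime N x G) (hS : PolyTime N x S)
    (hpos : ∀ i, ∀ g ∈ G i, g.1 + 1 < (S i).length)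
    (hGn : ∀ i, ∃ G', List.Forall₂ (NearGate (l i)) G' (G i))
    (hSn : ∀ i, ∃ S', List.Forall₂ (NearPair (l i) 2) S' (S i)) :
    PolyTime N x fun i => finalCells (Matchgate.fixedMul (l i)) (Matchgate.fixedOne (l i)) (k i) (G i)
      (S i) := by
  refine PolyTime.foldr (env := l) (step := fun l g L => Matchgate.applyGate (Matchgate.fixedMul l) g L)
    ?_ hl hG (initCells (fixedOne hlb hl) hk hS) ?_
  · have hlenS := hS.polyBdd_size.mono fun i => length_le_codeSize (S i)
    have hlenG := hG.polyBdd_size.mono fun i => length_le_codeSize (G i)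
    have : PolyBdd N fun i =>
        (S i).length * ((12 * (9 * (G i).length + l i) + 80) + 1) + 2 :=
      (hlenS.mul ((((PolyBdd.const 12).mul (((PolyBdd.const 9).mul hlenG).add hlb)).add
        (.const 80)).add (.const 1))).add (.const 2)
    obtain ⟨T, hT⟩ := this
    refine ⟨T, fun p => le_trans ?_ (hT p.1)⟩
    obtain ⟨G', hG'⟩ := hGn p.1
    obtain ⟨S', hS'⟩ := hSn p.1
    have hn := nearCell_finalCells (k p.1) hS' (List.forall₂_drop p.2 hG')
    have h1 := codeSize_list_le (forall_codeSize_le_of_forall₂ hn)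
    rw [length_finalCells] at h1
    refine h1.trans ?_
    have h2 : ((G p.1).drop p.2).length ≤ (G p.1).length := by simp
    beta_reduce
    gcongr
  · intro κ r j hj y he hs ha
    refine applyGate (hlb.reindex r) he ha hs fun p => ?_
    have := length_finalCells (Matchgate.fixedMul (l (r p))) (Matchgate.fixedOne (l (r p))) (k (r p))
      ((G (r p)).drop (j p + 1)) (S (r p))
    rw [Matchgate.finalCells] at this
    rw [this]
    exact hpos _ _ (List.getElem_mem _)

theorem simulate (hlb : PolyBdd N l) (hl : PolyTime N x l) (hk : PolyTime N x k)
    (hG : PolyTime N x G) (hS : PolyTime N x S)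
    (hpos : ∀ i, ∀ g ∈ G i, g.1 + 1 < (S i).length)
    (hGn : ∀ i, ∃ G', List.Forall₂ (NearGate (l i)) G' (G i))
    (hSn : ∀ i, ∃ S', List.Forall₂ (NearPair (l i) 2) S' (S i)) :
    PolyTime N x fun i => simulate (Matchgate.fixedMul (l i)) (Matchgate.fixedOne (l i)) (k i) (G i)
      (S i) := by
  have hL := finalCells hlb hl hk hG hS hpos hGn hSn
  have h0 := hk.gaussian_zero
  refine (PolyTime.foldr (env := l) (step := fun l c E => Matchgate.scanStep (Matchgate.fixedMul l) c E)
    ?_ hl hL (h0.prodMk (h0.prodMk h0)) ?_).snd.snd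
  · have hlenS := hS.polyBdd_size.mono fun i => length_le_codeSize (S i)
    have hlenG := hG.polyBdd_size.mono fun i => length_le_codeSize (G i)
    have : PolyBdd N fun i =>
        6 * (9 * (G i).length + (12 * (S i).length + 9 * (G i).length) + l i) + 40 :=
      ((PolyBdd.const 6).mul ((((PolyBdd.const 9).mul hlenG).add
        (((PolyBdd.const 12).mul hlenS).add ((PolyBdd.const 9).mul hlenG))).add hlb)).add (.const 40)
    obtain ⟨T, hT⟩ := this
    refine ⟨T, fun p => le_trans ?_ (hT p.1)⟩
    obtain ⟨G', hG'⟩ := hGn p.1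
    obtain ⟨S', hS'⟩ := hSn p.1
    have hn := nearScan_foldr (one_le_pow₀ one_le_two)
      (List.forall₂_drop p.2 (nearCell_finalCells (k p.1) hS' hG'))
    rw [← pow_add] at hn
    refine hn.codeSize_le.trans ?_
    have h2 := length_finalCells (Matchgate.fixedMul (l p.1)) (Matchgate.fixedOne (l p.1)) (k p.1)
      (G p.1) (S p.1)
    rw [List.length_drop, h2]
    beta_reduce
    gcongr
    exact Nat.sub_le _ _
  · intro κ r j hj y he hs ha
    exact scanStep (hlb.reindex r) he ha hs

end

end PolyTime

/-! ## Descriptions to finitely many digits -/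

section Descriptions

variable {l w : ℕ}

/-- The bound `2` is one unit of error each for the real and the imaginary part; the later estimates
use it for input amplitudes and gate entries. -/
theorem ApproxComplex.exists_near {c : ℂ} {d : Data} (h : ApproxComplex l c d) (hc : ‖c‖ ≤ 1) :
    ∃ z : GaussianInt, d = code z ∧ Near l 2 c z := by
  obtain ⟨a, b, rfl, ha, hb⟩ := h
  refine ⟨⟨a, b⟩, rfl, hc.trans one_le_two, (Complex.norm_le_abs_re_add_abs_im _).trans ?_⟩
  rw [Complex.sub_re, Complex.sub_im, fixedVal_re, fixedVal_im]
  exact (add_le_add ha hb).trans (le_of_eq (by ring))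

theorem ApproxQubit.exists_near {v : Fin 2 → ℂ} {d : Data} (h : ApproxQubit l v d)
    (hv : ∀ b, ‖v b‖ ≤ 1) :
    ∃ z : GaussianInt × GaussianInt, d = code z ∧ NearPair l 2 (v 0, v 1) z := by
  obtain ⟨a, b, rfl, ha, hb⟩ := h
  obtain ⟨y, rfl, hy⟩ := ha.exists_near (hv 0)
  obtain ⟨z, rfl, hz⟩ := hb.exists_near (hv 1)
  exact ⟨(y, z), rfl, hy, hz⟩

theorem ApproxMatrix.exists_near {M : Matrix (Fin 2) (Fin 2) ℂ} {d : Data}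
    (h : ApproxMatrix l M d) (hM : M ∈ Matrix.unitaryGroup (Fin 2) ℂ) :
    ∃ z : Mat2 GaussianInt, d = code z ∧ NearMat l 2 (toMat2 M) z := by
  obtain ⟨a, b, rfl, ha, hb⟩ := h
  obtain ⟨y, rfl, hy⟩ := ha.exists_near fun _ => entry_norm_bound_of_unitary hM _ _
  obtain ⟨z, rfl, hz⟩ := hb.exists_near fun _ => entry_norm_bound_of_unitary hM _ _
  exact ⟨(y, z), rfl, hy, hz⟩

theorem ApproxGate.exists_near {g : Gate w} {d : Data} (h : ApproxGate l g d) :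
    ∃ z : ℕ × Mat2 GaussianInt × Mat2 GaussianInt, d = code z ∧ NearGate l (gateData g) z := by
  obtain ⟨a, b, rfl, ha, hb⟩ := h
  obtain ⟨y, rfl, hy⟩ := ha.exists_near g.A_unitary
  obtain ⟨z, rfl, hz⟩ := hb.exists_near g.B_unitary
  exact ⟨(g.pos, y, z), rfl, rfl, hy, hz⟩

theorem ApproxCircuit.exists_near {C : Circuit w} {d : Data} (h : ApproxCircuit l C d) :
    ∃ G : List (ℕ × Mat2 GaussianInt × Mat2 GaussianInt), d = code ((w : ℤ), G) ∧
      List.Forall₂ (NearGate l) (C.map gateData) G ∧ ∀ g ∈ G, g.1 + 1 < w := by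
  obtain ⟨e, rfl, h⟩ := h
  suffices H : ∃ G : List (ℕ × Mat2 GaussianInt × Mat2 GaussianInt), e = G.map code ∧
      List.Forall₂ (NearGate l) (C.map gateData) G ∧ ∀ g ∈ G, g.1 + 1 < w by
    obtain ⟨G, rfl, hG⟩ := H
    exact ⟨G, rfl, hG⟩
  induction h with
  | nil => exact ⟨[], rfl, .nil, by simp⟩
  | @cons g _ _ _ hg _ ih =>
    obtain ⟨z, rfl, hz⟩ := hg.exists_near
    obtain ⟨G, rfl, hG, hpos⟩ := ih
    refine ⟨z :: G, rfl, .cons hz hG, fun g' hg' => ?_⟩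
    rcases List.mem_cons.1 hg' with rfl | hg'
    · rw [← hz.1]
      exact g.pos_lt
    · exact hpos g' hg'

theorem ApproxProduct.exists_near {φ : Fin w → Fin 2 → ℂ} {s : Data}
    (hφ : ∀ j, ‖φ j 0‖ ^ 2 + ‖φ j 1‖ ^ 2 = 1) (h : ApproxProduct l φ s) :
    ∃ S : List (GaussianInt × GaussianInt), s = code S ∧
      List.Forall₂ (NearPair l 2) (amplitudes φ) S := by
  obtain ⟨e, rfl, he⟩ := h
  have : ∀ j, ∃ z : GaussianInt × GaussianInt, e j = code z ∧ NearPair l 2 (φ j 0, φ j 1) z :=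
    fun j => (he j).exists_near (Fin.forall_fin_two.2
      ⟨by nlinarith [hφ j, sq_nonneg ‖φ j 1‖], by nlinarith [hφ j, sq_nonneg ‖φ j 0‖]⟩)
  choose z hz hz' using this
  refine ⟨List.ofFn z, ?_, ?_⟩
  · change _ = Data.list ((List.ofFn z).map code)
    rw [List.map_ofFn]
    exact congrArg (fun e => Data.list (List.ofFn e)) (funext hz)
  · rw [amplitudes, List.forall₂_iff_get]
    exact ⟨by simp, fun i h₁ h₂ => by simpa using hz' _⟩

end Descriptions

/-! ## Rounding of the result -/

/-- The first `m` binary digits of `Y / 2 ^ (l + 1)`, rounded to nearest. -/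
def roundDigits (l m : ℕ) (Y : ℤ) : ℤ := (Y * 2 ^ m + 2 ^ l) / 2 ^ (l + 1)

/-- Half a unit of the `m`-th digit is spent on the approximation and half on rounding. Adding `2 ^
l` before the division turns rounding down into rounding to nearest. -/
theorem approxReal_roundDigits {l m : ℕ} {Y : ℤ} {r : ℝ}
    (h : |(Y : ℝ) / 2 ^ (l + 1) - r| ≤ 1 / 2 ^ (m + 1)) : ApproxReal m r (roundDigits l m Y) := by
  have hl : (0 : ℝ) < 2 ^ l := by positivity
  have hm : (0 : ℝ) < 2 ^ m := by positivity
  have h1 : (2 : ℤ) ^ (l + 1) * roundDigits l m Y ≤ Y * 2 ^ m + 2 ^ l :=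
    Int.mul_ediv_self_le (by positivity)
  have h2 : Y * 2 ^ m + 2 ^ l < (2 : ℤ) ^ (l + 1) * roundDigits l m Y + 2 ^ (l + 1) :=
    Int.lt_mul_ediv_self_add (by positivity)
  have h1' : (2 : ℝ) ^ (l + 1) * roundDigits l m Y ≤ Y * 2 ^ m + 2 ^ l := by exact_mod_cast h1
  have h2' : (Y : ℝ) * 2 ^ m + 2 ^ l < 2 ^ (l + 1) * roundDigits l m Y + 2 ^ (l + 1) := by
    exact_mod_cast h2
  have h3 : |(roundDigits l m Y : ℝ) / 2 ^ m - Y / 2 ^ (l + 1)| ≤ 1 / 2 ^ (m + 1) := by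
    have : (roundDigits l m Y : ℝ) / 2 ^ m - Y / 2 ^ (l + 1) =
        (2 ^ (l + 1) * roundDigits l m Y - Y * 2 ^ m) / (2 ^ (l + 1) * 2 ^ m) := by
      field_simp
    rw [this, abs_div, abs_of_pos (by positivity : (0 : ℝ) < 2 ^ (l + 1) * 2 ^ m),
      div_le_div_iff₀ (by positivity) (by positivity), one_mul]
    have : |(2 : ℝ) ^ (l + 1) * roundDigits l m Y - Y * 2 ^ m| ≤ 2 ^ l := by
      rw [abs_le]
      rw [pow_succ] at *
      constructor <;> linarith
    calc |(2 : ℝ) ^ (l + 1) * roundDigits l m Y - Y * 2 ^ m| * 2 ^ (m + 1) ≤ 2 ^ l * 2 ^ (m + 1) := by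
          gcongr
      _ = 2 ^ (l + 1) * 2 ^ m := by ring
  rw [ApproxReal]
  calc |(roundDigits l m Y : ℝ) / 2 ^ m - r|
      ≤ |(roundDigits l m Y : ℝ) / 2 ^ m - Y / 2 ^ (l + 1)| + |(Y : ℝ) / 2 ^ (l + 1) - r| :=
        abs_sub_le _ _ _
    _ ≤ 1 / 2 ^ (m + 1) + 1 / 2 ^ (m + 1) := add_le_add h3 h
    _ = 1 / 2 ^ m := by rw [pow_succ]; field_simp; norm_num

theorem PolyTime.roundDigits {ι : Type} {N : ι → ℕ} {x : ι → Data} {l m : ι → ℕ} {Y : ι → ℤ}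
    (hlb : PolyBdd N l) (hmb : PolyBdd N m) (hl : PolyTime N x l) (hm : PolyTime N x m)
    (hY : PolyTime N x Y) : PolyTime N x fun i => roundDigits (l i) (m i) (Y i) :=
  PolyTime.shiftRight (hlb.add (.const 1)) (hl.nat_add (hl.nat_const 1))
    ((hY.mul (PolyTime.two_pow hmb hm)).add (PolyTime.two_pow hlb hl))

/-- The numbers that are obtained from an approximate expectation value. -/
theorem approxReal_results {l m : ℕ} {E : ℤ} {r p₀ p₁ : ℝ}
    (hE : |(E : ℝ) / 2 ^ l - r| ≤ 1 / 2 ^ (m + 1)) (hr : r = p₀ - p₁) (h1 : p₀ + p₁ = 1) :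
    ApproxReal m r (roundDigits l m (2 * E)) ∧
      ApproxReal m p₀ (roundDigits l m (2 ^ l + E)) ∧
      ApproxReal m p₁ (roundDigits l m (2 ^ l - E)) := by
  have hl : (0 : ℝ) < 2 ^ l := by positivity
  have hm : (0 : ℝ) < 1 / 2 ^ (m + 1) := by positivity
  rw [abs_le] at hE
  refine ⟨approxReal_roundDigits ?_, approxReal_roundDigits ?_, approxReal_roundDigits ?_⟩
  · have : ((2 * E : ℤ) : ℝ) / 2 ^ (l + 1) = (E : ℝ) / 2 ^ l := by
      push_cast
      rw [pow_succ]
      field_simp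
    rw [this, abs_le]
    exact hE
  -- Here `p₀ = (1 + r) / 2`, and below `p₁ = (1 - r) / 2`; this halving is the extra digit in `l +
  -- 1`, for which `2 * E` compensates in the case of `r`.
  · have : ((2 ^ l + E : ℤ) : ℝ) / 2 ^ (l + 1) = (1 + (E : ℝ) / 2 ^ l) / 2 := by
      push_cast
      rw [pow_succ]
      field_simp
    rw [this, abs_le]
    constructor <;> linarith
  · have : ((2 ^ l - E : ℤ) : ℝ) / 2 ^ (l + 1) = (1 - (E : ℝ) / 2 ^ l) / 2 := by
      push_cast
      rw [pow_succ]
      field_simp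
    rw [this, abs_le]
    constructor <;> linarith

/-! ### The complete algorithm for a uniform family -/

/-- The list of gates that a uniform family provides, with polynomially many gates and in polynomial
time. -/
theorem IsUniform.exists_gates {w : ℕ → ℕ} {C : ∀ n, Circuit (w n)} (hC : IsUniform w C) :
    ∃ (T : Polynomial ℕ) (G : ℕ → ℕ → List (ℕ × Mat2 GaussianInt × Mat2 GaussianInt)),
      (∀ n, w n ≤ T.eval n) ∧ (∀ n l, (G n l).length ≤ T.eval n) ∧
      (∀ n l, List.Forall₂ (NearGate l) ((C n).map gateData) (G n l)) ∧
      (∀ n l, ∀ g ∈ G n l, g.1 + 1 < w n) ∧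
      PolyTime (fun p : ℕ × ℕ => p.1 + p.2) (fun p => code p) fun p => G p.1 p.2 := by
  obtain ⟨P, T, hw, hP⟩ := hC
  choose d t hrun ht happ using hP
  choose G hd hG hpos using fun n l => (happ n l).exists_near
  have hpoly : PolyTime (fun p : ℕ × ℕ => p.1 + p.2) (fun p => code p)
      fun p => ((w p.1 : ℤ), G p.1 p.2) :=
    ⟨P, T, fun p => ⟨t p.1 p.2, hd p.1 p.2 ▸ hrun p.1 p.2, ht p.1 p.2⟩⟩
  refine ⟨T, G, hw, fun n l => ?_, hG, hpos, hpoly.snd⟩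
  -- The gate count does not depend on the precision, so the description with `l = 0` bounds it by
  -- `n` alone. Otherwise the choice of `l` from the gate count would be circular.
  have h0 : (G n 0).length ≤ T.eval n := by
    have h1 := (hrun n 0).size_le.2.trans (ht n 0)
    rw [hd n 0] at h1
    have h2 : codeSize ((w n : ℤ), G n 0) ≤ T.eval (n + 0) := h1
    rw [codeSize_prod] at h2
    have h3 := length_le_codeSize (G n 0)
    simp only [add_zero] at h2
    omega
  rw [← (hG n l).length_eq, (hG n 0).length_eq]
  exact h0

theorem near_re_sub_le {l e m : ℕ} {c : ℂ} {z : GaussianInt} (h : Near l (2 ^ e) c z)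
    (hl : m + e + 1 ≤ l) : |(z.re : ℝ) / 2 ^ l - c.re| ≤ 1 / 2 ^ (m + 1) := by
  have h1 := (Complex.abs_re_le_norm _).trans h.2
  rw [Complex.sub_re, fixedVal_re] at h1
  refine h1.trans ?_
  rw [div_le_div_iff₀ (by positivity) (by positivity), one_mul, ← pow_add]
  exact pow_le_pow_right₀ one_le_two (by omega)

theorem NearPair.codeSize_le {l : ℕ} {c z} (h : NearPair l 2 c z) : codeSize z ≤ 4 * l + 30 := by
  have h2 : (2 : ℝ) ≤ 2 ^ 1 := by norm_num
  have h1 := (h.1.mono h2).codeSize_le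
  have h1' := (h.2.mono h2).codeSize_le
  rw [codeSize_prod]
  omega

theorem codeSize_amplitudes_le {l w : ℕ} {φ : Fin w → Fin 2 → ℂ} {S}
    (h : List.Forall₂ (NearPair l 2) (amplitudes φ) S) : codeSize S ≤ w * (4 * l + 31) + 2 := by
  have hlen : S.length = w := by rw [← h.length_eq, amplitudes, List.length_ofFn]
  have : ∀ z ∈ S, codeSize z ≤ 4 * l + 30 := by
    clear hlen
    generalize amplitudes φ = L at h
    induction h with
    | nil => simp
    | cons h _ ih =>
      intro z hz
      rcases List.mem_cons.1 hz with rfl | hz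
      · exact h.codeSize_le
      · exact ih z hz
  simpa [hlen] using codeSize_list_le this

/-- The inputs of the simulation: `n`, `m`, the measured line, and amplitudes to `q (n + m)` digits
of some product state. -/
abbrev Input (w : ℕ → ℕ) (q : Polynomial ℕ) : Type :=
  {p : ℕ × ℕ × ℕ × List (GaussianInt × GaussianInt) // p.2.2.1 < w p.1 ∧
    ∃ φ : Fin (w p.1) → Fin 2 → ℂ,
      List.Forall₂ (NearPair (q.eval (p.1 + p.2.1)) 2) (amplitudes φ) p.2.2.2}

/-- The final `0` in the tuples is the leaf that ends `Data.list`, so their codes are lists of four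
inputs and of three outputs. -/
theorem polyTime_results {w : ℕ → ℕ} {C : ∀ n, Circuit (w n)} {T : Polynomial ℕ}
    {G : ℕ → ℕ → List (ℕ × Mat2 GaussianInt × Mat2 GaussianInt)} (hw : ∀ n, w n ≤ T.eval n)
    (hG : ∀ n l, List.Forall₂ (NearGate l) ((C n).map gateData) (G n l))
    (hpos : ∀ n l, ∀ g ∈ G n l, g.1 + 1 < w n)
    (hpoly : PolyTime (fun p : ℕ × ℕ => p.1 + p.2) (fun p => code p) fun p => G p.1 p.2)
    (q : Polynomial ℕ) :
    PolyTime (fun i : Input w q => i.1.1 + i.1.2.1)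
      (fun i => code (i.1.1, i.1.2.1, i.1.2.2.1, i.1.2.2.2, (0 : ℤ))) fun i =>
        let l := q.eval (i.1.1 + i.1.2.1)
        let E := (simulate (fixedMul l) (fixedOne l) i.1.2.2.1 (G i.1.1 l) i.1.2.2.2).re
        (roundDigits l i.1.2.1 (2 * E), roundDigits l i.1.2.1 (2 ^ l + E),
          roundDigits l i.1.2.1 (2 ^ l - E), (0 : ℤ)) := by
  let N : Input w q → ℕ := fun i => i.1.1 + i.1.2.1
  let x : Input w q → Data := fun i => code (i.1.1, i.1.2.1, i.1.2.2.1, i.1.2.2.2, (0 : ℤ))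
  have hNn : PolyBdd N fun i => i.1.1 := PolyBdd.self.mono fun i => Nat.le_add_right _ _
  have hNm : PolyBdd N fun i => i.1.2.1 := PolyBdd.self.mono fun i => Nat.le_add_left _ _
  have hNw : PolyBdd N fun i => w i.1.1 := (hNn.poly T).mono fun i => hw _
  have hNl : PolyBdd N fun i => q.eval (i.1.1 + i.1.2.1) := PolyBdd.self.poly q
  have hin : PolyTime N x fun i => (i.1.1, i.1.2.1, i.1.2.2.1, i.1.2.2.2, (0 : ℤ)) := by
    refine PolyTime.input _ (((((hNn.add hNm).add hNw).add (hNw.mul (((PolyBdd.const 4).mul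
      hNl).add (.const 31)))).add (.const 20)).mono fun i => ?_)
    have h1 := codeSize_nat_le i.1.1
    have h2 := codeSize_nat_le i.1.2.1
    have h3 := codeSize_nat_le i.1.2.2.1
    have h4 := codeSize_amplitudes_le i.2.2.choose_spec
    have h5 := i.2.1
    have h6 : codeSize (0 : ℤ) = 2 := rfl
    simp only [codeSize_prod]
    omega
  have hn := hin.fst
  have hm := hin.snd.fst
  have hk := hin.snd.snd.fst.natCast
  have hS := hin.snd.snd.snd.fst
  have hl : PolyTime N x fun i => q.eval (i.1.1 + i.1.2.1) := (hn.nat_add hm).polynomial_eval q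
  -- The family is queried at precision `q (n + m)`, so its time bound in `n + l` becomes polynomial
  -- in `n + m`.
  have hg : PolyTime N x fun i => G i.1.1 (q.eval (i.1.1 + i.1.2.1)) :=
    (hn.prodMk hl).comp ((hpoly.reindex
      fun i : Input w q => (i.1.1, q.eval (i.1.1 + i.1.2.1))).mono_param (hNn.add hNl))
  have hE := (PolyTime.simulate hNl hl hk hg hS ?_ (fun i => ⟨_, hG _ _⟩)
    (fun i => ⟨_, i.2.2.choose_spec⟩)).re
  · have hp := PolyTime.two_pow hNl hl
    have hr {Y : Input w q → ℤ} (hY : PolyTime N x Y) := PolyTime.roundDigits hNl hNm hl hm hY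
    exact (hr ((hl.int_const 2).mul hE)).prodMk ((hr (hp.add hE)).prodMk
      ((hr (hp.sub hE)).prodMk (hl.int_const 0)))
  · intro i g hgi
    have hlen := i.2.2.choose_spec.length_eq
    rw [amplitudes, List.length_ofFn] at hlen
    rw [← hlen]
    exact hpos _ _ g hgi

end Matchgate

theorem theorem1 (w : ℕ → ℕ) (C : ∀ n, Matchgate.Circuit (w n))
    (hC : Matchgate.IsUniform w C) :
    ∃ (P : Matchgate.Prog) (T q : Polynomial ℕ),
      ∀ (n m : ℕ) (k : Fin (w n)) (φ : Fin (w n) → Fin 2 → ℂ),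
        (∀ j, ‖φ j 0‖ ^ 2 + ‖φ j 1‖ ^ 2 = 1) →
        let ψ := (C n).output (Matchgate.productState φ)
        Matchgate.expZ k ψ =
            ((Matchgate.outcomeProb k 0 ψ - Matchgate.outcomeProb k 1 ψ : ℝ) : ℂ) ∧
        ∀ s : Matchgate.Data, Matchgate.ApproxProduct (q.eval (n + m)) φ s →
          ∃ (z a b : ℤ) (t : ℕ),
            Matchgate.Runs P
              (Matchgate.Data.list [.int n, .int m, .int k, s])
              (Matchgate.Data.list [.int z, .int a, .int b]) t ∧
            t ≤ T.eval (n + m) ∧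
            Matchgate.ApproxReal m (Matchgate.expZ k ψ).re z ∧
            Matchgate.ApproxReal m (Matchgate.outcomeProb k 0 ψ) a ∧
            Matchgate.ApproxReal m (Matchgate.outcomeProb k 1 ψ) b := by
  obtain ⟨T, G, hw, hlen, hG, hpos, hpoly⟩ := hC.exists_gates
  -- Gates and lines each number at most `T n`, so the error exponent is at most `(18 + 12) * T n`.
  -- One more digit leaves half a unit for the final rounding.
  obtain ⟨P, T', hP⟩ := Matchgate.polyTime_results hw hG hpos hpoly
    (Polynomial.X + Polynomial.C 30 * T + 1)
  refine ⟨P, T', Polynomial.X + Polynomial.C 30 * T + 1, fun n m k φ hφ => ?_⟩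
  set q : Polynomial ℕ := Polynomial.X + Polynomial.C 30 * T + 1 with hq
  intro ψ
  have hsub := Matchgate.expZ_eq_sub k ψ
  refine ⟨hsub, fun s hs => ?_⟩
  obtain ⟨S, rfl, hS⟩ := hs.exists_near hφ
  obtain ⟨t, hrun, ht⟩ := hP ⟨(n, m, k, S), k.2, φ, hS⟩
  have hE := Matchgate.near_simulate (k : ℕ) hS (hG n (q.eval (n + m)))
  rw [← Matchgate.expZ_eq_simulate k (C n) hφ] at hE
  have hSlen : S.length = w n := by rw [← hS.length_eq, Matchgate.amplitudes, List.length_ofFn]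
  have hadd : Matchgate.outcomeProb k 0 ψ + Matchgate.outcomeProb k 1 ψ = 1 := by
    have := Matchgate.outcomeProb_add k ψ
    rw [Matchgate.ip_output, Matchgate.ip_productState hφ] at this
    exact_mod_cast this
  have hl : m + (18 * (G n (q.eval (n + m))).length + 12 * S.length) + 1 ≤ q.eval (n + m) := by
    have h1 := hlen n (q.eval (n + m))
    have h2 := hw n
    have h3 : T.eval n ≤ T.eval (n + m) := Matchgate.polynomial_eval_mono T (Nat.le_add_right n m)
    have h4 : q.eval (n + m) = n + m + 30 * T.eval (n + m) + 1 := by simp [hq]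
    omega
  have hres := Matchgate.approxReal_results (Matchgate.near_re_sub_le hE hl)
    (by rw [hsub, Complex.ofReal_re]) hadd
  exact ⟨_, _, _, t, hrun, ht, hres⟩
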